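/- All matroids have ground set contained in a fixed set $\alpha$ (of labels). For a matrix $A$ over a field whose columns are indexed by a set $E$, the vector matroid of $A$ has ground set $E$, and $I\subseteq E$ is independent iff the columns of $A$ indexed by $I$ are linearly independent. If $X,Y$ are disjoint sets, a matrix $S$ with rows indexed by $X$ and columns indexed by $Y$ is a standard representation of $M$ if $M$ is the vector matroid of $[\,1\mid S\,]$, whose rows are indexed by $X$ and whose columns are indexed by $X\cup Y$. A matroid is regular if it is the vector matroid of a totally unimodular matrix over $\mathbb{Q}$. A matroid is graphic if it is the vector matroid of a rational matrix each of whose columns either is zero or has one entry $1$, one entry $-1$ and zeros elsewhere; it is cographic if its dual is graphic. $R_{10}$ is the matroid with standard representation $$\begin{bmatrix}1&0&0&1&1\\1&1&0&0&1\\0&1&1&0&1\\0&0&1&1&1\\1&1&1&1&1\end{bmatrix}\quad\text{over }\mathbb{Z}_2 .$$ Let $k\in\{1,2,3\}$. A matroid $M$ is a $k$-sum of $M_\ell$ and $M_r$ if there are standard representations $B_\ell\in\mathbb{Z}_2^{X_\ell\times Y_\ell}$ of $M_\ell$ and $B_r\in\mathbb{Z}_2^{X_r\times Y_r}$ of $M_r$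 such that $M$ has the following standard representation $B$ over $\mathbb{Z}_2$, with rows indexed by $X_\ell\cup X_r$ and columns indexed by $Y_\ell\cup Y_r$. * $k=1$: $X_\ell,Y_\ell,X_r,Y_r$ are pairwise disjoint and $B=\begin{bmatrix}B_\ell&0\\0&B_r\end{bmatrix}$. * $k=2$: $X_\ell\cap X_r=\{x\}$, $Y_\ell\cap Y_r=\{y\}$, $X_\ell$ and $X_r$ are disjoint from $Y_\ell$ and $Y_r$, the row $r=B_\ell(x,Y_\ell)$ and the column $c=B_r(X_r,y)$ are nonzero, and $B=\begin{bmatrix}A_\ell&0\\c\otimes r&A_r\end{bmatrix}$, where $A_\ell$ is $B_\ell$ without row $x$ and $A_r$ is $B_r$ without column $y$. * $k=3$: $X_\ell\cap X_r=\{x_2,x_1,x_0\}$ and $Y_\ell\cap Y_r=\{y_0,y_1,y_2\}$ (each with three distinct elements), $X_\ell\cap Y_r=Y_\ell\cap X_r=\emptyset$; both $B_\ell$ and $B_r$ have entries $1$ at $(x_2,y_0),(x_2,y_1),(x_1,y_2),(x_0,y_2)$; column $y_2$ of $B_\ell$ is $0$ outside rows $x_1,x_0$; row $x_2$ of $B_r$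 is $0$ outside columns $y_0,y_1$; and $B_\ell$, $B_r$ have the same submatrix $D_0$ on $\{x_1,x_0\}\times\{y_0,y_1\}$, which is invertible. Then $$B=\begin{bmatrix}A_\ell&0\\D&A_r\end{bmatrix},\qquad D=\begin{bmatrix}D_\ell&D_0\\D_{\ell r}&D_r\end{bmatrix},\qquad D_{\ell r}=D_r D_0^{-1}D_\ell,$$ where $A_\ell=B_\ell(X_\ell\setminus\{x_1,x_0\},\,Y_\ell\setminus\{y_2\})$, $A_r=B_r(X_r\setminus\{x_2\},\,Y_r\setminus\{y_0,y_1\})$, $D_\ell=B_\ell(\{x_1,x_0\},\,Y_\ell\setminus\{y_0,y_1,y_2\})$ and $D_r=B_r(X_r\setminus\{x_2,x_1,x_0\},\,\{y_0,y_1\})$. The class of good matroids is the smallest class that contains all graphic matroids, all cographic matroids and all matroids isomorphic to $R_{10}$, and that contains every $1$-sum, every $2$-sum and every $3$-sum of two of its members. Theorem. Every good matroid of finite rank (in particular, every finite good matroid) is regular. -/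

import Mathlib

open scoped Classical

universe u v w

noncomputable section

/-! ### Vector matroids and standard representations -/

section VectorMatroid

variable {α : Type u} {X : Type v} {R : Type w} [DivisionRing R] {E : Set α}

/-- `A.IndepCols I` says that `I` is a subset of the set `E` of column labels of `A` and that the
columns of `A` indexed by `I` are linearly independent. -/
def Matrix.IndepCols (A : Matrix X E R) (I : Set α) : Prop :=
  I ⊆ E ∧ LinearIndepOn R A.col {e : E | (e : α) ∈ I}

/-- The vector matroid of a matrix `A` whose columns are indexed by the set `E`: its ground set is
`E`, and `I ⊆ E` is independent iff the columns of `A` indexed by `I` are linearly independent. -/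
def Matrix.toMatroid (A : Matrix X E R) : Matroid α :=
  (IndepMatroid.ofFinitary E A.IndepCols
    (by
      refine ⟨Set.empty_subset _, ?_⟩
      simp)
    (by
      intro I J hJ hIJ
      exact ⟨hIJ.trans hJ.1, hJ.2.mono fun e he => hIJ he⟩)
    (by
      have key : ∀ (I : Set α) (e : E), A.IndepCols I → (e : α) ∉ I →
          ¬ A.IndepCols (insert (e : α) I) →
          A.col e ∈ Submodule.span R (A.col '' {f : E | (f : α) ∈ I}) := by
        intro I e hI heI h
        by_contra hcon
        apply h
        refine ⟨Set.insert_subset e.2 hI.1, ?_⟩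
        have hset : {f : E | (f : α) ∈ insert (e : α) I} = insert e {f : E | (f : α) ∈ I} := by
          ext f
          simp [Subtype.ext_iff]
        rw [hset]
        exact hI.2.insert hcon
      intro I B hI hImax hBmax
      by_contra! hno
      have hspan : ∀ b : E, (b : α) ∈ B →
          A.col b ∈ Submodule.span R (A.col '' {f : E | (f : α) ∈ I}) := by
        intro b hb
        by_cases hbI : (b : α) ∈ I
        · exact Submodule.subset_span ⟨b, hbI, rfl⟩
        · exact key I b hI hbI (hno b ⟨hb, hbI⟩)
      apply hImax
      refine ⟨hI, fun J hJ hIJ => ?_⟩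
      intro e heJ
      by_contra heI
      let e' : E := ⟨e, hJ.1 heJ⟩
      have hmem : A.col e' ∈ Submodule.span R (A.col '' {f : E | (f : α) ∈ I}) := by
        by_cases heB : e ∈ B
        · exact hspan e' heB
        · have h1 : A.col e' ∈ Submodule.span R (A.col '' {f : E | (f : α) ∈ B}) := by
            apply key B e' hBmax.1 heB
            intro h
            exact heB (hBmax.2 h (Set.subset_insert _ _) (Set.mem_insert _ _))
          refine (Submodule.span_le.2 ?_) h1
          rintro _ ⟨b, hb, rfl⟩
          exact hspan b hb
      have hins : LinearIndepOn R A.col (insert e' {f : E | (f : α) ∈ I}) := by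
        refine hJ.2.mono ?_
        rintro f (rfl | hf)
        · exact heJ
        · exact hIJ hf
      exact (linearIndepOn_insert (s := {f : E | (f : α) ∈ I}) (a := e') heI).1 hins |>.2 hmem)
    (by
      intro I hI
      refine ⟨fun e he => (hI {e} (by simpa using he) (Set.finite_singleton e)).1 rfl, ?_⟩
      rw [linearIndepOn_iff_linearIndepOn_finset]
      intro t ht
      refine (hI (Subtype.val '' (t : Set E)) ?_ (t.finite_toSet.image _)).2.mono ?_
      · rintro _ ⟨e, he, rfl⟩
        exact ht he
      · intro e he
        exact ⟨e, he, rfl⟩)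
    (fun I hI => hI.1)).matroid

theorem Matrix.toMatroid_ground (A : Matrix X E R) : A.toMatroid.E = E := rfl

theorem Matrix.toMatroid_indep_iff (A : Matrix X E R) (I : Set α) :
    A.toMatroid.Indep I ↔ I ⊆ E ∧ LinearIndepOn R A.col {e : E | (e : α) ∈ I} := Iff.rfl

end VectorMatroid

section StandardRepr

variable {α : Type u} {R : Type w} [DivisionRing R]

/-- The matrix `[1 | S]`, whose rows are indexed by `X` and whose columns are indexed by `X ∪ Y`. -/
def Matrix.prependOne {X Y : Set α} (S : Matrix X Y R) : Matrix X (X ∪ Y : Set α) R :=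
  fun i e => if h : (e : α) ∈ X then (if (i : α) = e then 1 else 0)
    else S i ⟨e, e.2.resolve_left h⟩

/-- `S` is a standard representation of `M`: the row labels `X` and the column labels `Y` of `S`
are disjoint, and `M` is the vector matroid of `[1 | S]`. -/
def Matrix.IsStandardReprOf {X Y : Set α} (S : Matrix X Y R) (M : Matroid α) : Prop :=
  Disjoint X Y ∧ S.prependOne.toMatroid = M

/-- The entry of a matrix at a pair of labels, extended by `0` to pairs of elements of `α` that are
not labels of the matrix. -/
def Matrix.entry {X Y : Set α} (S : Matrix X Y R) (i j : α) : R :=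
  if h : i ∈ X ∧ j ∈ Y then S ⟨i, h.1⟩ ⟨j, h.2⟩ else 0

end StandardRepr

/-! ### Regular matroids -/

/-- A matroid is regular if it is the vector matroid of a totally unimodular rational matrix. -/
def Matroid.IsRegular {α : Type u} (M : Matroid α) : Prop :=
  ∃ (X : Type u) (E : Set α) (A : Matrix X E ℚ), A.IsTotallyUnimodular ∧ A.toMatroid = M

/-! ### Sums of binary matrices and of matroids -/

section Sums

variable {α : Type u} {Xl Yl Xr Yr : Set α}

/-- The `1`-sum of matrices, i.e. the block matrix `[Bl 0; 0 Br]`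
(to be used for pairwise disjoint `Xl`, `Yl`, `Xr`, `Yr`). -/
def standardReprSum1 (Bl : Matrix Xl Yl (ZMod 2)) (Br : Matrix Xr Yr (ZMod 2)) :
    Matrix (Xl ∪ Xr : Set α) (Yl ∪ Yr : Set α) (ZMod 2) :=
  fun i j =>
    if (i : α) ∈ Xl ∧ (j : α) ∈ Yl then Bl.entry i j
    else if (i : α) ∈ Xr ∧ (j : α) ∈ Yr then Br.entry i j
    else 0

/-- `M` is a `1`-sum of `Ml` and `Mr`. -/
def Matroid.IsSum1of (M Ml Mr : Matroid α) : Prop :=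
  ∃ (Xl Yl Xr Yr : Set α) (Bl : Matrix Xl Yl (ZMod 2)) (Br : Matrix Xr Yr (ZMod 2)),
    (Disjoint Xl Yl ∧ Disjoint Xl Xr ∧ Disjoint Xl Yr ∧
      Disjoint Yl Xr ∧ Disjoint Yl Yr ∧ Disjoint Xr Yr) ∧
    Bl.IsStandardReprOf Ml ∧ Br.IsStandardReprOf Mr ∧
    (standardReprSum1 Bl Br).IsStandardReprOf M

/-- The `2`-sum of matrices with common row label `x` and common column label `y`, i.e. the block
matrix `[Al 0; D Ar]` with rows `Xl \ {x}` and `Xr`, columns `Yl` and `Yr \ {y}`, where `Al` is `Bl`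
without its row `x`, `Ar` is `Br` without its column `y`, and `D` is the outer product of the column
`y` of `Br` and the row `x` of `Bl`. As `x ∈ Xr` and `y ∈ Yl`, the row labels of the result are
`(Xl \ {x}) ∪ Xr = Xl ∪ Xr`, and its column labels are `Yl ∪ (Yr \ {y}) = Yl ∪ Yr`. -/
def standardReprSum2 (Bl : Matrix Xl Yl (ZMod 2)) (Br : Matrix Xr Yr (ZMod 2)) (x y : α) :
    Matrix (Xl ∪ Xr : Set α) (Yl ∪ Yr : Set α) (ZMod 2) :=
  fun i j =>
    if (i : α) ∈ Xr then
      -- the bottom rows: `D` and `Ar`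
      if (j : α) ∈ Yl then Br.entry i y * Bl.entry x j else Br.entry i j
    else
      -- the top rows: `Al` and `0`
      if (j : α) ∈ Yl then Bl.entry i j else 0

/-- `M` is a `2`-sum of `Ml` and `Mr`. -/
def Matroid.IsSum2of (M Ml Mr : Matroid α) : Prop :=
  ∃ (Xl Yl Xr Yr : Set α) (Bl : Matrix Xl Yl (ZMod 2)) (Br : Matrix Xr Yr (ZMod 2)) (x y : α),
    (Xl ∩ Xr = {x} ∧ Yl ∩ Yr = {y} ∧
      Disjoint Xl Yl ∧ Disjoint Xl Yr ∧ Disjoint Xr Yl ∧ Disjoint Xr Yr) ∧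
    (∃ j ∈ Yl, Bl.entry x j ≠ 0) ∧ (∃ i ∈ Xr, Br.entry i y ≠ 0) ∧
    Bl.IsStandardReprOf Ml ∧ Br.IsStandardReprOf Mr ∧
    (standardReprSum2 Bl Br x y).IsStandardReprOf M

/-- The `2 × 2` submatrix of `B` with rows `x1`, `x0` and columns `y0`, `y1`. -/
def sum3D0 {X Y : Set α} (B : Matrix X Y (ZMod 2)) (x0 x1 y0 y1 : α) :
    Matrix (Fin 2) (Fin 2) (ZMod 2) :=
  !![B.entry x1 y0, B.entry x1 y1; B.entry x0 y0, B.entry x0 y1]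

/-- The `3`-sum of matrices with common row labels `x2, x1, x0` and common column labels
`y0, y1, y2`, i.e. the block matrix with rows `Xl \ {x1, x0}` (top) and `Xr \ {x2}` (bottom) and
columns `Yl \ {y2}` (left) and `Yr \ {y0, y1}` (right), where
* the top left block `Al` is taken from `Bl`, the bottom right block `Ar` is taken from `Br`, and the
  top right block is `0`;
* the bottom left block is `[Dl D0; Dlr Dr]` with rows `{x1, x0}` and `Xr \ {x2, x1, x0}` and columns
  `Yl \ {y0, y1, y2}` and `{y0, y1}`; here `Dl` and `D0` are taken from `Bl`, `Dr` is taken from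
  `Br`, and `Dlr = Dr * D0⁻¹ * Dl`.
The row labels of the result are `Xl ∪ Xr`, and its column labels are `Yl ∪ Yr`. -/
def standardReprSum3 (Bl : Matrix Xl Yl (ZMod 2)) (Br : Matrix Xr Yr (ZMod 2))
    (x0 x1 y0 y1 y2 : α) :
    Matrix (Xl ∪ Xr : Set α) (Yl ∪ Yr : Set α) (ZMod 2) :=
  fun i j =>
    if (i : α) ∈ Xl \ {x1, x0} then
      -- the top rows: `Al` and `0`
      if (j : α) ∈ Yl \ {y2} then Bl.entry i j else 0
    else
      if (j : α) ∈ Yl \ {y2} then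
        if (i : α) = x1 ∨ (i : α) = x0 then
          -- `Dl` and `D0`
          Bl.entry i j
        else if (j : α) = y0 ∨ (j : α) = y1 then
          -- `Dr`
          Br.entry i j
        else
          -- `Dlr`
          ![Br.entry i y0, Br.entry i y1] ⬝ᵥ
            ((sum3D0 Bl x0 x1 y0 y1)⁻¹.mulVec ![Bl.entry x1 j, Bl.entry x0 j])
      else
        -- `Ar`
        Br.entry i j

/-- `M` is a `3`-sum of `Ml` and `Mr`. -/
def Matroid.IsSum3of (M Ml Mr : Matroid α) : Prop :=
  ∃ (Xl Yl Xr Yr : Set α) (Bl : Matrix Xl Yl (ZMod 2)) (Br : Matrix Xr Yr (ZMod 2))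
    (x0 x1 x2 y0 y1 y2 : α),
    (x0 ≠ x1 ∧ x0 ≠ x2 ∧ x1 ≠ x2 ∧ y0 ≠ y1 ∧ y0 ≠ y2 ∧ y1 ≠ y2) ∧
    (Xl ∩ Xr = {x2, x1, x0} ∧ Yl ∩ Yr = {y0, y1, y2} ∧ Disjoint Xl Yr ∧ Disjoint Yl Xr) ∧
    -- the shape of `Bl`
    (Bl.entry x2 y0 = 1 ∧ Bl.entry x2 y1 = 1 ∧ Bl.entry x1 y2 = 1 ∧ Bl.entry x0 y2 = 1 ∧
      ∀ i ∈ Xl \ {x1, x0}, Bl.entry i y2 = 0) ∧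
    -- the shape of `Br`
    (Br.entry x2 y0 = 1 ∧ Br.entry x2 y1 = 1 ∧ Br.entry x1 y2 = 1 ∧ Br.entry x0 y2 = 1 ∧
      ∀ j ∈ Yr \ {y0, y1}, Br.entry x2 j = 0) ∧
    -- the common invertible block `D0`
    sum3D0 Bl x0 x1 y0 y1 = sum3D0 Br x0 x1 y0 y1 ∧ IsUnit (sum3D0 Bl x0 x1 y0 y1) ∧
    Bl.IsStandardReprOf Ml ∧ Br.IsStandardReprOf Mr ∧
    (standardReprSum3 Bl Br x0 x1 y0 y1 y2).IsStandardReprOf M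

end Sums

/-! ### Special matroids -/

/-- A node-incidence matrix of a directed graph with nodes `X` and edges `Y`: each column either is
zero, or has an entry `1`, an entry `-1` in a different row, and zeros elsewhere. -/
def Matrix.IsGraphic {X : Type v} {Y : Type w} (A : Matrix X Y ℚ) : Prop :=
  ∀ j : Y, (∀ i : X, A i j = 0) ∨
    ∃ i₁ i₂ : X, i₁ ≠ i₂ ∧ A i₁ j = 1 ∧ A i₂ j = -1 ∧ ∀ i : X, i ≠ i₁ → i ≠ i₂ → A i j = 0

/-- A matroid is graphic if it is represented by a node-incidence matrix. -/
def Matroid.IsGraphic {α : Type u} (M : Matroid α) : Prop :=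
  ∃ (X : Type u) (E : Set α) (A : Matrix X E ℚ), A.IsGraphic ∧ A.toMatroid = M

/-- A matroid is cographic if its dual is graphic. -/
def Matroid.IsCographic {α : Type u} (M : Matroid α) : Prop :=
  M✶.IsGraphic

/-- The standard representation matrix of `R10`; the rows are labelled by `0, …, 4`, and the columns
are labelled by `5, …, 9`. -/
def matrixR10 : Matrix {i : Fin 10 | (i : ℕ) < 5} {j : Fin 10 | 5 ≤ (j : ℕ)} (ZMod 2) :=
  fun i j =>
    (!![1, 0, 0, 1, 1;
        1, 1, 0, 0, 1;
        0, 1, 1, 0, 1;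
        0, 0, 1, 1, 1;
        1, 1, 1, 1, 1] : Matrix (Fin 5) (Fin 5) (ZMod 2))
      ⟨(i : Fin 10), i.2⟩ ⟨((j : Fin 10) : ℕ) - 5, by omega⟩

/-- The matroid `R10`. -/
def matroidR10 : Matroid (Fin 10) :=
  matrixR10.prependOne.toMatroid

/-- `M` is isomorphic to `R10`: it is the image of `R10` under an injective relabelling. -/
def Matroid.IsIsomorphicToR10 {α : Type u} (M : Matroid α) : Prop :=
  ∃ (f : Fin 10 → α) (hf : Set.InjOn f matroidR10.E), M = matroidR10.map f hf

/-! ### Good matroids -/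

/-- Good matroids: the smallest class of matroids that contains the graphic matroids, the cographic
matroids and the matroids isomorphic to `R10` and that is closed under `1`-, `2`- and `3`-sums. -/
inductive Matroid.IsGood {α : Type u} : Matroid α → Prop
  | graphic {M : Matroid α} (hM : M.IsGraphic) : M.IsGood
  | cographic {M : Matroid α} (hM : M.IsCographic) : M.IsGood
  | isomorphicR10 {M : Matroid α} (hM : M.IsIsomorphicToR10) : M.IsGood
  | sum1 {M Ml Mr : Matroid α} (hM : M.IsSum1of Ml Mr) (hl : Ml.IsGood) (hr : Mr.IsGood) : M.IsGood
  | sum2 {M Ml Mr : Matroid α} (hM : M.IsSum2of Ml Mr) (hl : Ml.IsGood) (hr : Mr.IsGood) : M.IsGood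
  | sum3 {M Ml Mr : Matroid α} (hM : M.IsSum3of Ml Mr) (hl : Ml.IsGood) (hr : Mr.IsGood) : M.IsGood

end

/-! A totally unimodular (TU) rational matrix and its reduction mod 2 have the same vector matroid:
each minor of the former is 0 or ±1, so it vanishes iff it is even. Hence a binary standard
representation with a TU signing represents a regular matroid (`IsSigningOf.isRegular`). Conversely,
every binary standard representation of a regular matroid of finite rank has a TU signing
(`IsStandardReprOf.exists_isSigningOf`): the coordinates of the columns of a TU matrix with respect
to a base form a TU matrix by Cramer's rule, and the matroid dictates its support. So closure under
sums becomes a statement about signings, whichever representations the sum uses.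

All three sums have the shape [A 0; CKR B], glued from [A 0; R T] and [W 0; C B], with K of size 0,
1 or 2. `IsTotallyUnimodular.fromBlocks_mul_mul` reduces their minors by pivoting. A pivot in A
changes only A and R, a pivot in B only B and C, and what remains is a minor of CKR. Since T and W
survive every pivot, it is enough to bound det(CKR) for all R and C compatible with T and W. For the
3-sum, K is a signed lift of the inverse of D₀, chosen by `exists_signed_two_by_two`.

For the starting classes: incidence matrices are TU by Poincaré's lemma; the dual of a matroid
represented by [1 | S] is represented by [-Sᵀ | 1], which is TU with S; and the 0/1 matrix of R10 is
already TU over the integers. Finite rank passes from a sum to its summands, so the induction goes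
through. -/

/-! ### Arithmetic of {0, ±1} -/

theorem mem_range_signType_cast_iff (x : ℚ) :
    x ∈ Set.range (SignType.cast : SignType → ℚ) ↔ x = 0 ∨ x = 1 ∨ x = -1 := by
  constructor
  · rintro ⟨s, rfl⟩
    cases s <;> simp
  · rintro (rfl | rfl | rfl)
    · exact ⟨0, by simp⟩
    · exact ⟨1, by simp⟩
    · exact ⟨-1, by simp⟩

theorem mul_mem_range_signType_cast {x y : ℚ} (hx : x ∈ Set.range (SignType.cast : SignType → ℚ))
    (hy : y ∈ Set.range (SignType.cast : SignType → ℚ)) :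
    x * y ∈ Set.range (SignType.cast : SignType → ℚ) := by
  rw [mem_range_signType_cast_iff] at *
  rcases hx with rfl | rfl | rfl <;> rcases hy with rfl | rfl | rfl <;> simp

theorem neg_one_pow_mul_mem_range_signType_cast_iff (n : ℕ) (x : ℚ) :
    (-1) ^ n * x ∈ Set.range (SignType.cast : SignType → ℚ) ↔
      x ∈ Set.range (SignType.cast : SignType → ℚ) := by
  simp only [mem_range_signType_cast_iff]
  rcases neg_one_pow_eq_or ℚ n with h | h <;> rw [h]
  · simp
  · simp only [neg_mul, one_mul, neg_eq_zero, neg_inj]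
    constructor <;> rintro (h | h | h) <;> grind

theorem unit_mul_mem_range_signType_cast_iff {a x : ℚ}
    (ha : a ∈ Set.range (SignType.cast : SignType → ℚ)) (ha0 : a ≠ 0) :
    a * x ∈ Set.range (SignType.cast : SignType → ℚ) ↔
      x ∈ Set.range (SignType.cast : SignType → ℚ) := by
  rw [mem_range_signType_cast_iff] at ha
  rcases ha with rfl | rfl | rfl
  · exact absurd rfl ha0
  · rw [one_mul]
  · simpa using neg_one_pow_mul_mem_range_signType_cast_iff 1 x

/-! ### Pivoting -/

namespace Matrix

variable {m n : Type*}

/-- The Schur complement of the entry of `A` at `(p, q)`, on all rows and columns of `A`. -/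
def schur (A : Matrix m n ℚ) (p : m) (q : n) : Matrix m n ℚ :=
  of fun i j => A i j - A i q / A p q * A p j

theorem schur_apply (A : Matrix m n ℚ) (p : m) (q : n) (i : m) (j : n) :
    A.schur p q i j = A i j - A i q / A p q * A p j := rfl

/-- Subtracting multiples of row `i₀` clears the rest of column `j₀`; then expand along that column.
-/
theorem det_eq_mul_det_schur {k : ℕ} (A : Matrix (Fin (k + 1)) (Fin (k + 1)) ℚ)
    (i₀ j₀ : Fin (k + 1)) (h : A i₀ j₀ ≠ 0) :
    A.det = (-1) ^ (i₀ + j₀ : ℕ) * (A i₀ j₀ *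
      ((A.schur i₀ j₀).submatrix i₀.succAbove j₀.succAbove).det) := by
  let A' : Matrix (Fin (k + 1)) (Fin (k + 1)) ℚ :=
    of fun i j => if i = i₀ then A i j else A.schur i₀ j₀ i j
  have hA : A.det = A'.det := by
    refine det_eq_of_forall_row_eq_smul_add_const (fun i => if i = i₀ then 0 else A i j₀ / A i₀ j₀)
      i₀ (by simp) fun i j => ?_
    by_cases hi : i = i₀ <;> simp [A', hi, schur_apply]
  rw [hA, det_succ_column A' j₀, Finset.sum_eq_single i₀]
  · have : A'.submatrix i₀.succAbove j₀.succAbove =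
        (A.schur i₀ j₀).submatrix i₀.succAbove j₀.succAbove := by
      ext i j
      simp [A', Fin.succAbove_ne]
    rw [this]
    simp only [A', of_apply, if_true]
    ring
  · intro i _ hi
    simp [A', hi, schur_apply, h]
  · simp

/-- Bordering a minor of the Schur complement by row `p` and column `q` gives a minor of `A`, equal
to the former times the pivot, which is ±1. -/
theorem IsTotallyUnimodular.schur {A : Matrix m n ℚ} (hA : A.IsTotallyUnimodular) {p : m} {q : n}
    (h : A p q ≠ 0) : (A.schur p q).IsTotallyUnimodular := by
  rw [isTotallyUnimodular_iff]
  intro k f g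
  have h1 := (isTotallyUnimodular_iff A).1 hA (k + 1) (Fin.cons p f) (Fin.cons q g)
  rw [det_eq_mul_det_schur _ 0 0 (by simpa using h), neg_one_pow_mul_mem_range_signType_cast_iff,
    unit_mul_mem_range_signType_cast_iff (by simpa using hA.apply p q) (by simpa using h)] at h1
  convert h1 using 2
  ext i j
  simp [schur_apply]

/-! ### Block matrices glued along a small matrix -/

variable {P P' Q Q' : Type*} {U V : Type*} {m : Type*} [Fintype m]

/-- The half of the gluing argument in which no row of `A` is left. A pivot in `B` keeps `W`,
because its column is zero there; it changes `C` and `B`, so these are generalized in the induction.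
Once no column of `B` is left, `hK` applies. -/
theorem det_mem_range_signType_cast_of_isTotallyUnimodular_right (K : Matrix m m ℚ)
    (T : Matrix m U ℚ) (W : Matrix V m ℚ)
    (hK : ∀ k (R : Matrix m (Fin k) ℚ) (C : Matrix (Fin k) m ℚ),
      (fromCols R T).IsTotallyUnimodular → (fromRows W C).IsTotallyUnimodular →
        (C * K * R).det ∈ Set.range (SignType.cast : SignType → ℚ))
    (R : Matrix m Q ℚ) (hR : (fromCols R T).IsTotallyUnimodular) {k : ℕ} :
    ∀ (C : Matrix P' m ℚ) (B : Matrix P' Q' ℚ), (fromBlocks W 0 C B).IsTotallyUnimodular →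
      ∀ (f : Fin k → P') (g : Fin k → Q ⊕ Q'),
      ((fromCols (C * K * R) B).submatrix f g).det ∈ Set.range (SignType.cast : SignType → ℚ) := by
  induction k with
  | zero => intro _ _ _ _ _; exact ⟨1, by simp⟩
  | succ k ih =>
    intro C B hN f g
    by_cases hg : ∃ j q, g j = Sum.inr q
    · obtain ⟨j₀, q, hj⟩ := hg
      by_cases h0 : ∀ i, B (f i) q = 0
      · refine ⟨0, ?_⟩
        rw [det_eq_zero_of_column_eq_zero j₀]
        · simp
        · intro i; simp [hj, h0]
      · push Not at h0
        obtain ⟨i₀, hi⟩ := h0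
        have hN' := hN.schur (p := Sum.inr (f i₀)) (q := Sum.inr q) (by simpa using hi)
        have hblocks : (fromBlocks W 0 C B).schur (Sum.inr (f i₀)) (Sum.inr q) =
            fromBlocks W 0 (of fun i j => C i j - B i q / B (f i₀) q * C (f i₀) j)
              (B.schur (f i₀) q) := by
          ext (i | i) (j | j) <;> simp [schur_apply]
        rw [hblocks] at hN'
        have hpiv : (fromCols (C * K * R) B).submatrix f g i₀ j₀ = B (f i₀) q := by simp [hj]
        rw [det_eq_mul_det_schur _ i₀ j₀ (by rwa [hpiv]),
          neg_one_pow_mul_mem_range_signType_cast_iff, hpiv]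
        refine mul_mem_range_signType_cast (hN.apply (Sum.inr (f i₀)) (Sum.inr q)) ?_
        convert ih _ _ hN' (f ∘ i₀.succAbove) (g ∘ j₀.succAbove) using 2
        ext i j
        simp only [schur_apply, submatrix_apply, hj, Function.comp, fromCols_apply_inr]
        rcases g (j₀.succAbove j) with a | a
        · simp only [fromCols_apply_inl, mul_apply, of_apply, sub_mul, Finset.sum_sub_distrib,
            Finset.mul_sum, Finset.sum_mul, mul_assoc]
        · simp [schur_apply]
    · have hg' : ∀ j, ∃ q, g j = Sum.inl q := by
        intro j
        rcases hgj : g j with a | a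
        · exact ⟨a, rfl⟩
        · exact (hg ⟨j, a, hgj⟩).elim
      choose g' hg' using hg'
      have := hK (k + 1) (R.submatrix id g') (C.submatrix f id) ?_ ?_
      · convert this using 2
        ext i j
        simp [hg', mul_apply]
      · convert hR.submatrix id (Sum.map g' id) using 1
        ext i (j | j) <;> simp
      · convert hN.submatrix (Sum.map id f) Sum.inl using 1
        ext (i | i) j <;> simp

/-- Total unimodularity of a generalized sum of two totally unimodular block matrices. -/
theorem IsTotallyUnimodular.fromBlocks_mul_mul (K : Matrix m m ℚ) {T : Matrix m U ℚ}
    {W : Matrix V m ℚ} (hK : ∀ k (R : Matrix m (Fin k) ℚ) (C : Matrix (Fin k) m ℚ),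
      (fromCols R T).IsTotallyUnimodular → (fromRows W C).IsTotallyUnimodular →
        (C * K * R).det ∈ Set.range (SignType.cast : SignType → ℚ))
    {A : Matrix P Q ℚ} {R : Matrix m Q ℚ} {C : Matrix P' m ℚ} {B : Matrix P' Q' ℚ}
    (hL : (fromBlocks A 0 R T).IsTotallyUnimodular)
    (hN : (fromBlocks W 0 C B).IsTotallyUnimodular) :
    (fromBlocks A 0 (C * K * R) B).IsTotallyUnimodular := by
  rw [isTotallyUnimodular_iff]
  intro k
  induction k generalizing A R with
  | zero => intro _ _; exact ⟨1, by simp⟩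
  | succ k ih =>
    intro f g
    by_cases hf : ∃ i p, f i = Sum.inl p
    · obtain ⟨i₀, p, hi⟩ := hf
      by_cases h0 : ∀ j, fromBlocks A 0 (C * K * R) B (Sum.inl p) (g j) = 0
      · refine ⟨0, ?_⟩
        rw [det_eq_zero_of_row_eq_zero i₀]
        · simp
        · intro j; rw [submatrix_apply, hi, h0]
      · push Not at h0
        obtain ⟨j₀, hj⟩ := h0
        rcases hgj : g j₀ with q | q
        swap
        · simp [hgj] at hj
        rw [hgj, fromBlocks_apply₁₁] at hj
        -- The pivot row is zero over `T`, so `T` is kept and `R` absorbs the change. Left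
        -- multiplication by `C * K` commutes with this row operation, so the glued matrix undergoes
        -- the same pivot.
        have hL' := hL.schur (p := Sum.inl p) (q := Sum.inl q) (by simpa using hj)
        have hblocks : (fromBlocks A 0 R T).schur (Sum.inl p) (Sum.inl q) =
            fromBlocks (A.schur p q) 0 (of fun i j => R i j - R i q / A p q * A p j) T := by
          ext (i | i) (j | j) <;> simp [schur_apply]
        rw [hblocks] at hL'
        have hpiv : (fromBlocks A 0 (C * K * R) B).submatrix f g i₀ j₀ = A p q := by simp [hi, hgj]
        rw [det_eq_mul_det_schur _ i₀ j₀ (by rwa [hpiv]),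
          neg_one_pow_mul_mem_range_signType_cast_iff, hpiv]
        refine mul_mem_range_signType_cast (hL.apply (Sum.inl p) (Sum.inl q)) ?_
        convert ih hL' (f ∘ i₀.succAbove) (g ∘ j₀.succAbove) using 2
        ext i j
        simp only [schur_apply, submatrix_apply, hi, hgj, Function.comp]
        rcases f (i₀.succAbove i) with b | b <;> rcases g (j₀.succAbove j) with a | a
        · simp [schur_apply]
        · simp
        · simp only [fromBlocks_apply₂₁, fromBlocks_apply₁₁, mul_apply, of_apply, mul_sub,
            Finset.sum_sub_distrib, Finset.sum_mul, Finset.sum_div]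
          congr 1
          refine Finset.sum_congr rfl fun x _ => ?_
          refine Finset.sum_congr rfl fun y _ => ?_
          ring
        · simp
    · have hf' : ∀ j, ∃ q, f j = Sum.inr q := by
        intro j
        rcases hfj : f j with a | a
        · exact (hf ⟨j, a, hfj⟩).elim
        · exact ⟨a, rfl⟩
      choose f' hf' using hf'
      convert det_mem_range_signType_cast_of_isTotallyUnimodular_right K T W hK R
        (hL.submatrix Sum.inr id) C B hN f' g using 2
      · ext i j
        rcases hgj : g j with a | a <;> simp [hf', hgj]

/-! ### Totally unimodular signings -/

variable {α : Type u}

theorem IsTotallyUnimodular.two_by_two {m n : Type*} {A : Matrix m n ℚ}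
    (hA : A.IsTotallyUnimodular) (i i' : m) (j j' : n) :
    A i j * A i' j' - A i j' * A i' j ∈ Set.range (SignType.cast : SignType → ℚ) := by
  have := (isTotallyUnimodular_iff A).1 hA 2 ![i, i'] ![j, j']
  rw [det_fin_two] at this
  simpa only [submatrix_apply, cons_val_zero, cons_val_one] using this

theorem det_mul_eq_zero_of_card_lt {m : Type*} [Fintype m] {k : ℕ} (hk : Fintype.card m < k)
    (C : Matrix (Fin k) m ℚ) (R : Matrix m (Fin k) ℚ) : (C * R).det = 0 := by
  by_contra h
  have h1 := rank_of_isUnit (C * R) ((isUnit_iff_isUnit_det _).2 (isUnit_iff_ne_zero.2 h))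
  have h2 := (rank_mul_le_left C R).trans (rank_le_card_width C)
  simp only [Fintype.card_fin] at h1
  omega

/-- The rational matrix `A` is a totally unimodular signing of the matrix `B` over `ZMod 2`. -/
def IsSigningOf {m n : Type*} (A : Matrix m n ℚ) (B : Matrix m n (ZMod 2)) : Prop :=
  A.IsTotallyUnimodular ∧ ∀ i j, ∃ z : ℤ, A i j = z ∧ B i j = z

section entry

variable {R : Type w} [DivisionRing R] {X Y : Set α}

theorem entry_of_mem (S : Matrix X Y R) {i j : α} (hi : i ∈ X) (hj : j ∈ Y) :
    S.entry i j = S ⟨i, hi⟩ ⟨j, hj⟩ := by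
  simp [entry, hi, hj]

theorem entry_of_notMem_left (S : Matrix X Y R) {i : α} (j : α) (hi : i ∉ X) :
    S.entry i j = 0 := by
  simp [entry, hi]

theorem entry_of_notMem_right (S : Matrix X Y R) (i : α) {j : α} (hj : j ∉ Y) :
    S.entry i j = 0 := by
  simp [entry, hj]

end entry

variable {X Y Xl Yl Xr Yr : Set α}

theorem IsTotallyUnimodular.entry {S : Matrix X Y ℚ} (hS : S.IsTotallyUnimodular) :
    (of S.entry).IsTotallyUnimodular := by
  rw [isTotallyUnimodular_iff]
  intro k f g
  by_cases hf : ∀ i, f i ∈ X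
  · by_cases hg : ∀ j, g j ∈ Y
    · convert (isTotallyUnimodular_iff S).1 hS k (fun i => ⟨f i, hf i⟩) (fun j => ⟨g j, hg j⟩)
        using 2
      ext i j
      simp [entry_of_mem S (hf i) (hg j)]
    · push Not at hg
      obtain ⟨j, hj⟩ := hg
      exact ⟨0, by rw [det_eq_zero_of_column_eq_zero j] <;> simp [entry_of_notMem_right S _ hj]⟩
  · push Not at hf
    obtain ⟨i, hi⟩ := hf
    exact ⟨0, by rw [det_eq_zero_of_row_eq_zero i] <;> simp [entry_of_notMem_left S _ hi]⟩

theorem IsSigningOf.entry {S : Matrix X Y ℚ} {B : Matrix X Y (ZMod 2)} (h : S.IsSigningOf B) :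
    (of S.entry).IsSigningOf (of B.entry) := by
  refine ⟨h.1.entry, fun i j => ?_⟩
  by_cases hij : i ∈ X ∧ j ∈ Y
  · obtain ⟨z, hz⟩ := h.2 ⟨i, hij.1⟩ ⟨j, hij.2⟩
    exact ⟨z, by simpa [Matrix.entry, hij] using hz⟩
  · exact ⟨0, by simp [Matrix.entry, hij]⟩

theorem IsSigningOf.apply_eq_zero_iff {m n : Type*} {A : Matrix m n ℚ} {B : Matrix m n (ZMod 2)}
    (h : A.IsSigningOf B) (i : m) (j : n) : A i j = 0 ↔ B i j = 0 := by
  obtain ⟨z, hz, hz'⟩ := h.2 i j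
  have := h.1.apply i j
  rw [mem_range_signType_cast_iff, hz] at this
  rw [hz, hz']
  norm_cast at this
  rcases this with rfl | rfl | rfl <;> simp

/-! ### Signings of 1-, 2- and 3-sums -/

/-- A `1`-sum of matrices that have totally unimodular signings has one. -/
theorem IsSigningOf.exists_sum1 {Sl : Matrix Xl Yl ℚ} {Sr : Matrix Xr Yr ℚ}
    {Bl : Matrix Xl Yl (ZMod 2)} {Br : Matrix Xr Yr (ZMod 2)}
    (hl : Sl.IsSigningOf Bl) (hr : Sr.IsSigningOf Br)
    (hX : Disjoint Xl Xr) (hY : Disjoint Yl Yr) :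
    ∃ S, IsSigningOf S (standardReprSum1 Bl Br) := by
  -- Gluing along an empty index type makes the connecting block zero.
  have key := IsTotallyUnimodular.fromBlocks_mul_mul (P := α) (Q := α) (P' := α) (Q' := α)
    (U := Empty) (V := Empty) (m := Empty) (A := of Sl.entry) (B := of Sr.entry) 0 (T := 0) (W := 0)
    (R := 0) (C := 0) ?_ ?_ ?_
  · let ρ : (Xl ∪ Xr : Set α) → α ⊕ α := fun i => if (i : α) ∈ Xl then Sum.inl i else Sum.inr i
    let κ : (Yl ∪ Yr : Set α) → α ⊕ α := fun j => if (j : α) ∈ Yl then Sum.inl j else Sum.inr j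
    refine ⟨_, key.submatrix ρ κ, fun i j => ?_⟩
    obtain ⟨zl, hzl, hzl'⟩ := hl.entry.2 i j
    obtain ⟨zr, hzr, hzr'⟩ := hr.entry.2 i j
    have hi := i.2
    have hj := j.2
    by_cases hil : (i : α) ∈ Xl <;> by_cases hjl : (j : α) ∈ Yl
    · exact ⟨zl, by simpa [ρ, κ, hil, hjl, standardReprSum1] using ⟨hzl, hzl'⟩⟩
    · have hir := hX.notMem_of_mem_left hil
      exact ⟨0, by simp [ρ, κ, hil, hjl, standardReprSum1, hir]⟩
    · have hjr := hY.notMem_of_mem_left hjl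
      exact ⟨0, by simp [ρ, κ, hil, hjl, standardReprSum1, hjr]⟩
    · have hir := hi.resolve_left hil
      have hjr := hj.resolve_left hjl
      exact ⟨zr, by simpa [ρ, κ, hil, hjl, hir, hjr, standardReprSum1] using ⟨hzr, hzr'⟩⟩
  · intro k R C _ _
    rcases k with _ | k
    · exact ⟨1, by simp⟩
    · exact ⟨0, by rw [Matrix.mul_assoc, det_mul_eq_zero_of_card_lt] <;> simp⟩
  · convert hl.1.entry.submatrix (Sum.elim id Empty.elim) (Sum.elim id Empty.elim) using 1
    ext (i | i) (j | j)
    · simp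
    · exact j.elim
    · exact i.elim
    · exact i.elim
  · convert hr.1.entry.submatrix (Sum.elim Empty.elim id) (Sum.elim Empty.elim id) using 1
    ext (i | i) (j | j)
    · exact i.elim
    · exact i.elim
    · exact j.elim
    · simp

/-- A `2`-sum of matrices that have totally unimodular signings has one. -/
theorem IsSigningOf.exists_sum2 {Sl : Matrix Xl Yl ℚ} {Sr : Matrix Xr Yr ℚ}
    {Bl : Matrix Xl Yl (ZMod 2)} {Br : Matrix Xr Yr (ZMod 2)}
    (hl : Sl.IsSigningOf Bl) (hr : Sr.IsSigningOf Br) (x y : α) :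
    ∃ S, IsSigningOf S (standardReprSum2 Bl Br x y) := by
  -- Gluing along one index with K = 1: the connecting block is the outer product of column `y` of
  -- `Sr` and row `x` of `Sl`.
  have key := IsTotallyUnimodular.fromBlocks_mul_mul (P := α) (Q := α) (P' := α) (Q' := α)
    (U := Empty) (V := Empty) (m := Unit) (A := of Sl.entry) (B := of Sr.entry) 1 (T := 0) (W := 0)
    (R := of fun _ j => Sl.entry x j) (C := of fun i _ => Sr.entry i y) ?_ ?_ ?_
  · let ρ : (Xl ∪ Xr : Set α) → α ⊕ α := fun i => if (i : α) ∈ Xr then Sum.inr i else Sum.inl i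
    let κ : (Yl ∪ Yr : Set α) → α ⊕ α := fun j => if (j : α) ∈ Yl then Sum.inl j else Sum.inr j
    refine ⟨_, key.submatrix ρ κ, fun i j => ?_⟩
    by_cases hir : (i : α) ∈ Xr <;> by_cases hjl : (j : α) ∈ Yl
    · obtain ⟨zl, hzl, hzl'⟩ := hl.entry.2 x j
      obtain ⟨zr, hzr, hzr'⟩ := hr.entry.2 i y
      rw [of_apply] at hzl hzl' hzr hzr'
      exact ⟨zr * zl, by simp [ρ, κ, hir, hjl, standardReprSum2, mul_apply, hzl, hzl', hzr, hzr']⟩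
    · obtain ⟨zr, hzr, hzr'⟩ := hr.entry.2 i j
      exact ⟨zr, by simpa [ρ, κ, hir, hjl, standardReprSum2] using ⟨hzr, hzr'⟩⟩
    · obtain ⟨zl, hzl, hzl'⟩ := hl.entry.2 i j
      exact ⟨zl, by simpa [ρ, κ, hir, hjl, standardReprSum2] using ⟨hzl, hzl'⟩⟩
    · exact ⟨0, by simp [ρ, κ, hir, hjl, standardReprSum2]⟩
  · intro k R C hR hC
    rcases k with _ | _ | k
    · exact ⟨1, by simp⟩
    · simpa [mul_apply] using mul_mem_range_signType_cast (hC.apply (Sum.inr 0) ())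
        (hR.apply () (Sum.inl 0))
    · exact ⟨0, by rw [det_mul_eq_zero_of_card_lt] <;> simp⟩
  · convert hl.1.entry.submatrix (Sum.elim id fun _ => x) (Sum.elim id Empty.elim) using 1
    ext (i | i) (j | j)
    · simp
    · exact j.elim
    · simp
    · exact j.elim
  · convert hr.1.entry.submatrix (Sum.elim Empty.elim id) (Sum.elim (fun _ => y) id) using 1
    ext (i | i) (j | j)
    · exact i.elim
    · exact i.elim
    · simp
    · simp

/-- Every invertible `2 × 2` matrix over `ZMod 2` lifts to an integer matrix whose entries, row
sums, column sums, sum of all entries and determinant all lie in `{0, ±1}`. -/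
theorem exists_signed_two_by_two (a b c d : ZMod 2) (h : a * d - b * c = 1) :
    ∃ p q r s : ℤ, ((p : ZMod 2) = a ∧ (q : ZMod 2) = b ∧ (r : ZMod 2) = c ∧ (s : ZMod 2) = d) ∧
      |p| ≤ 1 ∧ |q| ≤ 1 ∧ |r| ≤ 1 ∧ |s| ≤ 1 ∧ |p + q| ≤ 1 ∧ |r + s| ≤ 1 ∧ |p + r| ≤ 1 ∧
      |q + s| ≤ 1 ∧ |p + q + r + s| ≤ 1 ∧ |p * s - q * r| ≤ 1 := by
  fin_cases a <;> fin_cases b <;> fin_cases c <;> fin_cases d <;>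
    first
    | exact absurd (h : (_ : Fin 2) = _) (by decide)
    -- In each witness, nonzero entries in a common row or column have opposite signs, and so do two
    -- nonzero entries that are the only ones.
    | exact ⟨1, 0, 0, -1, ⟨rfl, rfl, rfl, rfl⟩, by simp⟩
    | exact ⟨0, 1, -1, 0, ⟨rfl, rfl, rfl, rfl⟩, by simp⟩
    | exact ⟨0, 1, 1, -1, ⟨rfl, rfl, rfl, rfl⟩, by simp⟩
    | exact ⟨1, 0, -1, 1, ⟨rfl, rfl, rfl, rfl⟩, by simp⟩
    | exact ⟨1, -1, 0, 1, ⟨rfl, rfl, rfl, rfl⟩, by simp⟩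
    | exact ⟨-1, 1, 1, 0, ⟨rfl, rfl, rfl, rfl⟩, by simp⟩

theorem intCast_mem_range_signType_cast {z : ℤ} (h : |z| ≤ 1) :
    (z : ℚ) ∈ Set.range (SignType.cast : SignType → ℚ) := by
  rw [mem_range_signType_cast_iff]
  norm_cast
  grind

/-- The bounds on the differences exclude opposite nonzero signs, so each of (c₀, c₁) and (r₀, r₁)
is ± a 0/1 vector. The bilinear form is then ± a sum over a subrectangle of the matrix, and `h`
bounds all of these. -/
theorem two_by_two_product_mem_range {p q r s : ℤ} {c₀ c₁ r₀ r₁ : ℚ}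
    (h : |p| ≤ 1 ∧ |q| ≤ 1 ∧ |r| ≤ 1 ∧ |s| ≤ 1 ∧ |p + q| ≤ 1 ∧ |r + s| ≤ 1 ∧ |p + r| ≤ 1 ∧
      |q + s| ≤ 1 ∧ |p + q + r + s| ≤ 1 ∧ |p * s - q * r| ≤ 1)
    (hc₀ : c₀ = 0 ∨ c₀ = 1 ∨ c₀ = -1) (hc₁ : c₁ = 0 ∨ c₁ = 1 ∨ c₁ = -1)
    (hr₀ : r₀ = 0 ∨ r₀ = 1 ∨ r₀ = -1) (hr₁ : r₁ = 0 ∨ r₁ = 1 ∨ r₁ = -1)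
    (hc : c₀ - c₁ = 0 ∨ c₀ - c₁ = 1 ∨ c₀ - c₁ = -1)
    (hr : r₀ - r₁ = 0 ∨ r₀ - r₁ = 1 ∨ r₀ - r₁ = -1) :
    c₀ * p * r₀ + c₀ * q * r₁ + c₁ * r * r₀ + c₁ * s * r₁ ∈
      Set.range (SignType.cast : SignType → ℚ) := by
  have aux : ∀ x y : ℚ, (x = 0 ∨ x = 1 ∨ x = -1) → (y = 0 ∨ y = 1 ∨ y = -1) →
      (x - y = 0 ∨ x - y = 1 ∨ x - y = -1) → ∃ e : ℤ, (e = 1 ∨ e = -1) ∧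
      ((x = e ∧ y = e) ∨ (x = e ∧ y = 0) ∨ (x = 0 ∧ y = e) ∨ (x = 0 ∧ y = 0)) := by
    rintro x y (rfl | rfl | rfl) (rfl | rfl | rfl) h
    · exact ⟨1, Or.inl rfl, by simp⟩
    · exact ⟨1, Or.inl rfl, by simp⟩
    · exact ⟨-1, Or.inr rfl, by simp⟩
    · exact ⟨1, Or.inl rfl, by simp⟩
    · exact ⟨1, Or.inl rfl, by simp⟩
    · norm_num at h
    · exact ⟨-1, Or.inr rfl, by simp⟩
    · norm_num at h
    · exact ⟨-1, Or.inr rfl, by simp⟩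
  obtain ⟨e, he, hc⟩ := aux c₀ c₁ hc₀ hc₁ hc
  obtain ⟨e', he', hr⟩ := aux r₀ r₁ hr₀ hr₁ hr
  have hee : |e * e'| = 1 := by rcases he with rfl | rfl <;> rcases he' with rfl | rfl <;> rfl
  have fin : ∀ z : ℤ, |z| ≤ 1 → (e * z * e' : ℚ) ∈ Set.range (SignType.cast : SignType → ℚ) := by
    intro z hz
    have : |e * e' * z| ≤ 1 := by rwa [abs_mul, hee, one_mul]
    convert intCast_mem_range_signType_cast this using 1
    push_cast
    ring
  obtain ⟨h1, h2, h3, h4, h5, h6, h7, h8, h9, h10⟩ := h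
  rcases hc with ⟨rfl, rfl⟩ | ⟨rfl, rfl⟩ | ⟨rfl, rfl⟩ | ⟨rfl, rfl⟩ <;>
  rcases hr with ⟨rfl, rfl⟩ | ⟨rfl, rfl⟩ | ⟨rfl, rfl⟩ | ⟨rfl, rfl⟩
  · convert fin _ h9 using 1; push_cast; ring
  · convert fin _ h7 using 1; push_cast; ring
  · convert fin _ h8 using 1; push_cast; ring
  · exact ⟨0, by simp⟩
  · convert fin _ h5 using 1; push_cast; ring
  · convert fin _ h1 using 1; ring
  · convert fin _ h2 using 1; ring
  · exact ⟨0, by simp⟩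
  · convert fin _ h6 using 1; push_cast; ring
  · convert fin _ h3 using 1; ring
  · convert fin _ h4 using 1; ring
  all_goals exact ⟨0, by simp⟩

theorem IsSigningOf.eq_one_or_neg_one {m n : Type*} {A : Matrix m n ℚ} {B : Matrix m n (ZMod 2)}
    (h : A.IsSigningOf B) {i : m} {j : n} (hij : B i j = 1) : A i j = 1 ∨ A i j = -1 := by
  have h0 : A i j ≠ 0 := by rw [Ne, h.apply_eq_zero_iff, hij]; exact one_ne_zero
  exact ((mem_range_signType_cast_iff _).1 (h.1.apply i j)).resolve_left h0

/-- A `3`-sum of matrices that have totally unimodular signings has one. -/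
theorem IsSigningOf.exists_sum3 {Sl : Matrix Xl Yl ℚ} {Sr : Matrix Xr Yr ℚ}
    {Bl : Matrix Xl Yl (ZMod 2)} {Br : Matrix Xr Yr (ZMod 2)}
    (hl : Sl.IsSigningOf Bl) (hr : Sr.IsSigningOf Br) {x0 x1 x2 y0 y1 y2 : α}
    (hBl1 : Bl.entry x1 y2 = 1) (hBl0 : Bl.entry x0 y2 = 1)
    (hBl : ∀ i ∈ Xl \ {x1, x0}, Bl.entry i y2 = 0)
    (hBr0 : Br.entry x2 y0 = 1) (hBr1 : Br.entry x2 y1 = 1)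
    (hBr : ∀ j ∈ Yr \ {y0, y1}, Br.entry x2 j = 0)
    (hy0 : y0 ∈ Yl \ {y2}) (hy1 : y1 ∈ Yl \ {y2})
    (hD : sum3D0 Bl x0 x1 y0 y1 = sum3D0 Br x0 x1 y0 y1) (hD0 : IsUnit (sum3D0 Bl x0 x1 y0 y1)) :
    ∃ S, IsSigningOf S (standardReprSum3 Bl Br x0 x1 y0 y1 y2) := by
  obtain ⟨a, b, c, d, ha, hb, hc, hd⟩ : ∃ a b c d : ZMod 2, Bl.entry x1 y0 = a ∧
    Bl.entry x1 y1 = b ∧ Bl.entry x0 y0 = c ∧ Bl.entry x0 y1 = d := ⟨_, _, _, _, rfl, rfl, rfl, rfl⟩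
  have ha' : Br.entry x1 y0 = a := by simpa [sum3D0, ha] using (congrFun₂ hD 0 0).symm
  have hb' : Br.entry x1 y1 = b := by simpa [sum3D0, hb] using (congrFun₂ hD 0 1).symm
  have hc' : Br.entry x0 y0 = c := by simpa [sum3D0, hc] using (congrFun₂ hD 1 0).symm
  have hd' : Br.entry x0 y1 = d := by simpa [sum3D0, hd] using (congrFun₂ hD 1 1).symm
  have hdet : a * d - b * c = 1 := by
    have := ((isUnit_iff_isUnit_det _).1 hD0).ne_zero
    simp only [sum3D0, ha, hb, hc, hd, det_fin_two_of] at this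
    exact ((by decide : ∀ z : Fin 2, z ≠ 0 → z = 1) _ this)
  -- This is the adjugate, as the determinant is 1 and signs are irrelevant in characteristic 2.
  have hinv : (sum3D0 Bl x0 x1 y0 y1)⁻¹ = !![d, b; c, a] := by
    refine inv_eq_right_inv ?_
    have h2 : ∀ z : ZMod 2, z + z = 0 := CharTwo.add_self_eq_zero
    ext i j
    fin_cases i <;> fin_cases j <;> simp [sum3D0, ha, hb, hc, hd]
    · linear_combination hdet + h2 (b * c)
    · linear_combination h2 (a * b)
    · linear_combination h2 (c * d)
    · linear_combination hdet + h2 (b * c)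
  obtain ⟨p, q, r, s, ⟨hp, hq, hr', hs⟩, hK⟩ := exists_signed_two_by_two d b c a
    (by rw [← hdet]; ring)
  let ys : Fin 2 → α := ![y0, y1]
  let xs : Fin 2 → α := ![x1, x0]
  let K₀ : Matrix (Fin 2) (Fin 2) ℤ := !![p, q; r, s]
  -- Multiplying the lift of D₀⁻¹ by the signs in row `x2` of `Sr` and column `y2` of `Sl` amounts
  -- to rescaling so that W and T become all-ones vectors.
  let K : Matrix (Fin 2) (Fin 2) ℚ :=
    of fun i j => Sr.entry x2 (ys i) * K₀ i j * Sl.entry (xs j) y2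
  -- The upper rows and right-hand columns are restricted to labels for which column `y2` of `Bl`,
  -- respectively row `x2` of `Br`, vanishes; labels outside the matrix qualify because `entry` is 0
  -- there.
  have key := IsTotallyUnimodular.fromBlocks_mul_mul (P := {i : α // i ∉ Xl ∨ i ∈ Xl \ {x1, x0}})
    (Q := α) (P' := α) (Q' := {j : α // j ∉ Yr ∨ j ∈ Yr \ {y0, y1}}) (U := Unit) (V := Unit)
    (m := Fin 2) (A := of fun i j => Sl.entry i j) (B := of fun i j => Sr.entry i j) K
    (T := of fun i _ => Sl.entry (xs i) y2) (W := of fun _ j => Sr.entry x2 (ys j))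
    (R := of fun i j => Sl.entry (xs i) j) (C := of fun i j => Sr.entry i (ys j)) ?_ ?_ ?_
  · let ρ : (Xl ∪ Xr : Set α) → {i : α // i ∉ Xl ∨ i ∈ Xl \ {x1, x0}} ⊕ α :=
      fun i => if h : (i : α) ∈ Xl \ {x1, x0} then Sum.inl ⟨i, Or.inr h⟩ else Sum.inr i
    have hκ : ∀ j : (Yl ∪ Yr : Set α), (j : α) ∉ Yl \ {y2} →
        (j : α) ∉ Yr ∨ (j : α) ∈ Yr \ {y0, y1} := by
      intro j hj
      by_cases hjr : (j : α) ∈ Yr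
      · right
        refine ⟨hjr, ?_⟩
        rintro (h | h)
        · exact hj (h ▸ hy0)
        · exact hj (h ▸ hy1)
      · exact Or.inl hjr
    let κ : (Yl ∪ Yr : Set α) → α ⊕ {j : α // j ∉ Yr ∨ j ∈ Yr \ {y0, y1}} :=
      fun j => if h : (j : α) ∈ Yl \ {y2} then Sum.inl j else Sum.inr ⟨j, hκ j h⟩
    refine ⟨_, key.submatrix ρ κ, fun i j => ?_⟩
    rw [submatrix_apply]
    by_cases hi : (i : α) ∈ Xl \ {x1, x0} <;> by_cases hj : (j : α) ∈ Yl \ {y2}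
    · have hρi : ρ i = Sum.inl ⟨i, Or.inr hi⟩ := dif_pos hi
      have hκj : κ j = Sum.inl (j : α) := dif_pos hj
      have hB : standardReprSum3 Bl Br x0 x1 y0 y1 y2 i j = Bl.entry i j := by
        rw [standardReprSum3, if_pos hi, if_pos hj]
      rw [hρi, hκj, hB]
      exact hl.entry.2 i j
    · have hρi : ρ i = Sum.inl ⟨i, Or.inr hi⟩ := dif_pos hi
      have hκj : κ j = Sum.inr ⟨j, hκ j hj⟩ := dif_neg hj
      have hB : standardReprSum3 Bl Br x0 x1 y0 y1 y2 i j = 0 := by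
        rw [standardReprSum3, if_pos hi, if_neg hj]
      rw [hρi, hκj, hB]
      exact ⟨0, by simp⟩
    · have hρi : ρ i = Sum.inr (i : α) := dif_neg hi
      have hκj : κ j = Sum.inl (j : α) := dif_pos hj
      -- The whole lower left block is C D₀⁻¹ R over `ZMod 2`: in rows `x1`, `x0` the factor C is
      -- D₀, leaving R, and in columns `y0`, `y1` the factor R is D₀, leaving C.
      have hB : standardReprSum3 Bl Br x0 x1 y0 y1 y2 i j =
          Br.entry i y0 * d * Bl.entry x1 j + Br.entry i y1 * c * Bl.entry x1 j +
          (Br.entry i y0 * b * Bl.entry x0 j + Br.entry i y1 * a * Bl.entry x0 j) := by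
        have h2 : ∀ z : ZMod 2, z + z = 0 := CharTwo.add_self_eq_zero
        rw [standardReprSum3, if_neg hi, if_pos hj]
        by_cases h1 : (i : α) = x1
        · rw [if_pos (Or.inl h1), h1, ha', hb']
          linear_combination -Bl.entry x1 j * hdet - h2 (a * b * Bl.entry x0 j) -
            h2 (b * c * Bl.entry x1 j)
        by_cases h0 : (i : α) = x0
        · rw [if_pos (Or.inr h0), h0, hc', hd']
          linear_combination -Bl.entry x0 j * hdet - h2 (c * d * Bl.entry x1 j) -
            h2 (b * c * Bl.entry x0 j)
        rw [if_neg (not_or.2 ⟨h1, h0⟩)]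
        by_cases hj0 : (j : α) = y0
        · rw [if_pos (Or.inl hj0), hj0, ha, hc]
          linear_combination -Br.entry i y0 * hdet - h2 (a * c * Br.entry i y1) -
            h2 (b * c * Br.entry i y0)
        by_cases hj1 : (j : α) = y1
        · rw [if_pos (Or.inr hj1), hj1, hb, hd]
          linear_combination -Br.entry i y1 * hdet - h2 (b * d * Br.entry i y0) -
            h2 (b * c * Br.entry i y1)
        rw [if_neg (not_or.2 ⟨hj0, hj1⟩), hinv]
        simp [dotProduct, mulVec, Fin.sum_univ_two]
        ring
      choose zl hzl hzl' using hl.entry.2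
      choose zr hzr hzr' using hr.entry.2
      simp only [of_apply] at hzl hzl' hzr hzr'
      rw [hρi, hκj, hB]
      refine ⟨∑ k, ∑ l, zr i (ys l) * (zr x2 (ys l) * K₀ l k * zl (xs k) y2) * zl (xs k) j, ?_, ?_⟩
      · simp [mul_apply, K, hzl, hzr]
        ring
      · simp [Fin.sum_univ_two, ← hzl', ← hzr', xs, ys, K₀, hBl0, hBl1, hBr0, hBr1, hp, hq, hr', hs]
    · have hρi : ρ i = Sum.inr (i : α) := dif_neg hi
      have hκj : κ j = Sum.inr ⟨j, hκ j hj⟩ := dif_neg hj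
      have hB : standardReprSum3 Bl Br x0 x1 y0 y1 y2 i j = Br.entry i j := by
        rw [standardReprSum3, if_neg hi, if_neg hj]
      rw [hρi, hκj, hB]
      exact hr.entry.2 i j
  · have ht : ∀ i, Sl.entry (xs i) y2 = 1 ∨ Sl.entry (xs i) y2 = -1 := by
      intro i
      apply hl.entry.eq_one_or_neg_one (i := xs i)
      fin_cases i <;> assumption
    have hw : ∀ i, Sr.entry x2 (ys i) = 1 ∨ Sr.entry x2 (ys i) = -1 := by
      intro i
      apply hr.entry.eq_one_or_neg_one (j := ys i)
      fin_cases i <;> assumption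
    have hprod : ∀ {x y : ℚ}, x = 1 ∨ x = -1 → y ∈ Set.range (SignType.cast : SignType → ℚ) →
        x * y ∈ Set.range (SignType.cast : SignType → ℚ) := by
      intro x y hx hy
      exact mul_mem_range_signType_cast ((mem_range_signType_cast_iff x).2 (Or.inr hx)) hy
    have hsq : ∀ {x : ℚ}, x = 1 ∨ x = -1 → x * x = 1 := by
      rintro x (rfl | rfl) <;> norm_num
    intro k R C hR hC
    rcases k with _ | _ | _ | k
    · exact ⟨1, by simp⟩
    · have hR0 := hprod (ht 0) (hR.apply 0 (Sum.inl 0))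
      have hR1 := hprod (ht 1) (hR.apply 1 (Sum.inl 0))
      have hC0 := hprod (hw 0) (hC.apply (Sum.inr 0) 0)
      have hC1 := hprod (hw 1) (hC.apply (Sum.inr 0) 1)
      -- Total unimodularity of [R | T] and of [W; C] bounds these 2 × 2 minors; after rescaling by
      -- the signs in T and W they are the differences required by `two_by_two_product_mem_range`.
      have hRR := hR.two_by_two 0 1 (Sum.inl 0) (Sum.inr ())
      have hCC := hC.two_by_two (Sum.inl ()) (Sum.inr 0) 1 0
      have hRR' := hprod (ht 0) (hprod (ht 1) hRR)
      have hCC' := hprod (hw 0) (hprod (hw 1) hCC)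
      simp only [fromCols_apply_inl, fromCols_apply_inr, fromRows_apply_inl, fromRows_apply_inr,
        of_apply, mem_range_signType_cast_iff] at hR0 hR1 hC0 hC1 hRR' hCC'
      have hRd : Sl.entry (xs 0) y2 * (Sl.entry (xs 1) y2 * (R 0 0 * Sl.entry (xs 1) y2 -
          Sl.entry (xs 0) y2 * R 1 0)) =
          Sl.entry (xs 0) y2 * R 0 0 - Sl.entry (xs 1) y2 * R 1 0 := by
        linear_combination Sl.entry (xs 0) y2 * R 0 0 * hsq (ht 1) -
          Sl.entry (xs 1) y2 * R 1 0 * hsq (ht 0)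
      have hCd : Sr.entry x2 (ys 0) * (Sr.entry x2 (ys 1) * (Sr.entry x2 (ys 1) * C 0 0 -
          Sr.entry x2 (ys 0) * C 0 1)) =
          Sr.entry x2 (ys 0) * C 0 0 - Sr.entry x2 (ys 1) * C 0 1 := by
        linear_combination Sr.entry x2 (ys 0) * C 0 0 * hsq (hw 1) -
          Sr.entry x2 (ys 1) * C 0 1 * hsq (hw 0)
      rw [hRd] at hRR'
      rw [hCd] at hCC'
      convert two_by_two_product_mem_range hK hC0 hC1 hR0 hR1 hCC' hRR' using 1
      simp [mul_apply, Fin.sum_univ_two, K, K₀]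
      ring
    · rw [det_mul, det_mul]
      refine mul_mem_range_signType_cast (mul_mem_range_signType_cast ?_ ?_) ?_
      · exact (isTotallyUnimodular_iff _).1 hC 2 Sum.inr id
      · have := hprod (hw 0) (hprod (hw 1) (hprod (ht 0) (hprod (ht 1)
          (intCast_mem_range_signType_cast hK.2.2.2.2.2.2.2.2.2))))
        convert this using 1
        simp [det_fin_two, K, K₀]
        ring
      · exact (isTotallyUnimodular_iff _).1 hR 2 id Sum.inl
    · exact ⟨0, by rw [Matrix.mul_assoc, det_mul_eq_zero_of_card_lt] <;> simp⟩
  · convert hl.1.entry.submatrix (Sum.elim Subtype.val xs) (Sum.elim id fun _ => y2) using 1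
    ext (i | i) (j | j)
    · simp
    · have : Bl.entry i y2 = 0 := i.2.elim (entry_of_notMem_left _ _) (hBl i)
      simpa using ((hl.entry.apply_eq_zero_iff _ _).2 this).symm
    · simp
    · simp
  · convert hr.1.entry.submatrix (Sum.elim (fun _ => x2) id) (Sum.elim ys Subtype.val) using 1
    ext (i | i) (j | j)
    · simp
    · have : Br.entry x2 j = 0 := j.2.elim (entry_of_notMem_right _ _) (hBr j)
      simpa using ((hr.entry.apply_eq_zero_iff _ _).2 this).symm
    · simp
    · simp

/-! ### Minors, linear independence and coordinates -/

/-- A functional vanishing on all rows is a linear relation among the columns, so the rows span the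
whole space and contain a basis of it, even if there are infinitely many rows. -/
theorem exists_det_submatrix_ne_zero_of_linearIndependent_col {R ι K : Type*} [Field K] [Fintype ι]
    [DecidableEq ι] {A : Matrix R ι K} (hA : LinearIndependent K A.col) :
    ∃ f : ι → R, (A.submatrix f id).det ≠ 0 := by
  have htop : Submodule.span K (Set.range A.row) = ⊤ := by
    by_contra hne
    obtain ⟨φ, hφ, hker⟩ := Submodule.exists_le_ker_of_lt_top _ (lt_top_iff_ne_top.2 hne)
    apply hφ
    have hφA : ∀ v : ι → K, φ v = ∑ i, φ (Pi.single i 1) * v i := by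
      intro v
      conv_lhs => rw [pi_eq_sum_univ' v]
      simp [mul_comm]
    have hc := Fintype.linearIndependent_iff.1 hA (fun i => φ (Pi.single i 1)) (by
      ext r
      have : φ (A.row r) = 0 := hker (Submodule.subset_span ⟨r, rfl⟩)
      rw [hφA] at this
      simpa using this)
    ext i
    simpa using hc i
  obtain ⟨κ, a, _, hspan, hli⟩ := exists_linearIndependent' K A.row
  let B := Module.Basis.mk hli (by rw [hspan, htop])
  have : Fintype κ := FiniteDimensional.fintypeBasisIndex B
  have hcard : Fintype.card κ = Fintype.card ι := by
    rw [← Module.finrank_eq_card_basis B, Module.finrank_fintype_fun_eq_card]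
  let e : ι ≃ κ := (Fintype.equivOfCardEq hcard).symm
  refine ⟨a ∘ e, ?_⟩
  have h1 : LinearIndependent K (A.submatrix (a ∘ e) id).row := hli.comp e e.injective
  exact ((isUnit_iff_isUnit_det _).1 (linearIndependent_rows_iff_isUnit.1 h1)).ne_zero

theorem linearIndependent_col_iff_exists_det_ne_zero {R ι K : Type*} [Field K] [Fintype ι]
    [DecidableEq ι] (A : Matrix R ι K) :
    LinearIndependent K A.col ↔ ∃ f : ι → R, (A.submatrix f id).det ≠ 0 := by
  refine ⟨exists_det_submatrix_ne_zero_of_linearIndependent_col, ?_⟩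
  rintro ⟨f, hf⟩
  have := linearIndependent_cols_of_det_ne_zero hf
  exact this.of_comp (LinearMap.funLeft K K f)

/-- The coordinates of columns of a totally unimodular matrix with respect to linearly independent
columns form a totally unimodular matrix. -/
theorem IsTotallyUnimodular.of_linearCombination {R N X Y : Type*} {A : Matrix R N ℚ}
    (hA : A.IsTotallyUnimodular) (b : X → N) (g : Y → N)
    (hb : LinearIndependent ℚ fun x => A.col (b x)) (s : Y → X →₀ ℚ)
    (hs : ∀ y, A.col (g y) = Finsupp.linearCombination ℚ (fun x => A.col (b x)) (s y)) :
    (of fun x y => s y x : Matrix X Y ℚ).IsTotallyUnimodular := by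
  intro k f h hf _
  -- `J` collects the other basis columns that occur in the coordinates of the chosen columns, so
  -- that finitely many basis columns suffice.
  let J : Finset X := (Finset.univ.biUnion fun j => (s (h j)).support) \ Finset.univ.image f
  let b' : Fin k ⊕ J → X := Sum.elim f Subtype.val
  have hb' : Function.Injective b' := by
    refine hf.sumElim Subtype.val_injective ?_
    rintro i ⟨j, hj⟩ rfl
    simp [J] at hj
  obtain ⟨ρ, hρ⟩ := exists_det_submatrix_ne_zero_of_linearIndependent_col
    (A := A.submatrix id (b ∘ b')) (hb.comp b' hb')
  -- Cramer's rule: the block triangular factor has the wanted minor as its determinant, and the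
  -- other two determinants are minors of `A`, the one on the left being nonzero.
  have hprod : (A.submatrix id (b ∘ b')).submatrix ρ id *
      fromBlocks (of fun i j => s (h j) (f i)) 0 (of fun (i : J) j => s (h j) i) 1 =
      A.submatrix ρ (Sum.elim (fun j => g (h j)) fun i : J => b i) := by
    ext r (j | j)
    · have hj : A (ρ r) (g (h j)) = ∑ x ∈ Finset.univ.image b', s (h j) x * A (ρ r) (b x) := by
        have := congrFun (hs (h j)) (ρ r)
        rw [Finsupp.linearCombination_apply,
          Finsupp.sum_of_support_subset (s := Finset.univ.image b')
          _ _ _ (by simp)] at this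
        · simpa [Finset.sum_apply] using this
        · intro x hx
          by_cases hxf : x ∈ Finset.univ.image f
          · obtain ⟨i, -, rfl⟩ := Finset.mem_image.1 hxf
            exact Finset.mem_image.2 ⟨Sum.inl i, Finset.mem_univ _, rfl⟩
          · have hxJ : x ∈ J := by
              simp only [J, Finset.mem_sdiff, hxf, Finset.mem_biUnion]
              exact ⟨⟨j, Finset.mem_univ _, hx⟩, not_false⟩
            exact Finset.mem_image.2 ⟨Sum.inr ⟨x, hxJ⟩, Finset.mem_univ _, rfl⟩
      rw [Finset.sum_image (fun x _ y _ hxy => hb' hxy)] at hj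
      simp only [submatrix_apply, Sum.elim_inl, hj, mul_apply]
      refine Finset.sum_congr rfl ?_
      rintro (i | i) _ <;> simp [b', mul_comm]
    · simp [mul_apply, b', one_apply]
  have hdet := congrArg det hprod
  rw [det_mul, det_fromBlocks_zero₁₂, det_one, mul_one] at hdet
  have hTU := (isTotallyUnimodular_iff_fintype A).1 hA
  have h1 := hTU _ ρ (Sum.elim (fun j => g (h j)) fun i : J => b i)
  rw [← hdet] at h1
  have h2 : ((A.submatrix id (b ∘ b')).submatrix ρ id).det ∈
      Set.range (SignType.cast : SignType → ℚ) := hTU _ ρ (b ∘ b')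
  have h3 := (unit_mul_mem_range_signType_cast_iff h2 hρ).1 h1
  exact h3

/-! ### Closure and rank in vector matroids -/

section matroid

variable {α : Type u} {X : Type v} {R : Type w} [DivisionRing R] {E : Set α}

/-- For independent sets, both sides say that adding `e` brings nothing new or destroys
independence. A basis of `I` has the same closure and the same span as `I`. -/
theorem toMatroid_mem_closure_iff (A : Matrix X E R) {I : Set α} (hI : I ⊆ E) (e : E) :
    (e : α) ∈ A.toMatroid.closure I ↔
      A.col e ∈ Submodule.span R (A.col '' {f : E | (f : α) ∈ I}) := by
  have key : ∀ J : Set α, A.toMatroid.Indep J → ∀ e : E, ((e : α) ∈ A.toMatroid.closure J ↔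
      A.col e ∈ Submodule.span R (A.col '' {f : E | (f : α) ∈ J})) := by
    intro J hJ e
    by_cases he : (e : α) ∈ J
    · exact iff_of_true (A.toMatroid.subset_closure J hJ.subset_ground he)
        (Submodule.subset_span ⟨e, he, rfl⟩)
    · rw [hJ.mem_closure_iff', toMatroid_ground, toMatroid_indep_iff]
      have hset : {f : E | (f : α) ∈ insert (e : α) J} = insert e {f : E | (f : α) ∈ J} := by
        ext f
        simp [Subtype.ext_iff]
      rw [hset, linearIndepOn_insert (show e ∉ {f : E | (f : α) ∈ J} from he)]
      have h2 : LinearIndepOn R A.col {f : E | (f : α) ∈ J} := ((A.toMatroid_indep_iff J).1 hJ).2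
      have h3 : insert (e : α) J ⊆ E := Set.insert_subset e.2 hJ.subset_ground
      simp [h2, h3, he]
  obtain ⟨J, hJ⟩ := A.toMatroid.exists_isBasis I hI
  rw [← hJ.closure_eq_closure, key J hJ.indep]
  suffices Submodule.span R (A.col '' {f : E | (f : α) ∈ J}) =
      Submodule.span R (A.col '' {f : E | (f : α) ∈ I}) by rw [this]
  apply le_antisymm
  · exact Submodule.span_mono (Set.image_mono fun f hf => hJ.subset hf)
  · rw [Submodule.span_le]
    rintro _ ⟨f, hf, rfl⟩
    exact (key J hJ.indep f).1 (hJ.subset_closure hf)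

theorem toMatroid_rankFinite [Finite X] (A : Matrix X E R) : A.toMatroid.RankFinite := by
  obtain ⟨B, hB⟩ := A.toMatroid.exists_isBase
  refine hB.rankFinite_of_finite ?_
  have h := ((A.toMatroid_indep_iff B).1 hB.indep).2
  have hfin : {e : E | (e : α) ∈ B}.Finite := LinearIndependent.finite_of_isNoetherian h
  refine (hfin.image Subtype.val).subset fun e he => ⟨⟨e, hB.subset_ground he⟩, he, rfl⟩

end matroid

/-! ### A signing represents the same matroid -/

theorem IsSigningOf.submatrix {m n m' n' : Type*} {A : Matrix m n ℚ} {B : Matrix m n (ZMod 2)}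
    (h : A.IsSigningOf B) (f : m' → m) (g : n' → n) :
    (A.submatrix f g).IsSigningOf (B.submatrix f g) :=
  ⟨h.1.submatrix f g, fun i j => h.2 (f i) (g j)⟩

/-- A matrix over `ZMod 2` is determined by its support. -/
theorem isSigningOf_of_apply_eq_zero_iff {m n : Type*} {A : Matrix m n ℚ} {B : Matrix m n (ZMod 2)}
    (hA : A.IsTotallyUnimodular) (h : ∀ i j, A i j = 0 ↔ B i j = 0) : A.IsSigningOf B := by
  refine ⟨hA, fun i j => ?_⟩
  have hB : B i j ≠ 0 → B i j = 1 := fun hne => (by decide : ∀ z : Fin 2, z ≠ 0 → z = 1) _ hne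
  rcases (mem_range_signType_cast_iff _).1 (hA.apply i j) with h0 | h1 | h1
  · exact ⟨0, by simp [h0], by simp [(h i j).1 h0]⟩
  · have := hB fun h0 => by simp [(h i j).2 h0] at h1
    exact ⟨1, by simp [h1], by simp [this]⟩
  · have := hB fun h0 => by simp [(h i j).2 h0] at h1
    exact ⟨-1, by simp [h1], by simp [this]⟩

/-- Both determinants are images of one integer determinant, which is 0 or ±1 and hence zero iff
even. -/
theorem IsSigningOf.det_eq_zero_iff {n : Type*} [Fintype n] [DecidableEq n] {A : Matrix n n ℚ}
    {B : Matrix n n (ZMod 2)} (h : A.IsSigningOf B) : A.det = 0 ↔ B.det = 0 := by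
  choose z hz hz' using h.2
  have hA : A.det = ((of z).det : ℤ) := by
    rw [Int.cast_det]
    congr 1
    ext i j
    simp [hz]
  have hB : B.det = ((of z).det : ℤ) := by
    rw [Int.cast_det]
    congr 1
    ext i j
    simp [hz']
  have hdet := (isTotallyUnimodular_iff_fintype A).1 h.1 n id id
  rw [submatrix_id_id, mem_range_signType_cast_iff, hA] at hdet
  rw [hA, hB]
  norm_cast at hdet
  rcases hdet with h | h | h <;> rw [h] <;> simp

/-- Independence can be tested on finite sets of columns, where it is the nonvanishing of some
minor, a condition that agrees over the two fields. -/
theorem IsSigningOf.toMatroid_eq {α : Type u} {X : Type v} {E : Set α} {A : Matrix X E ℚ}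
    {B : Matrix X E (ZMod 2)} (h : A.IsSigningOf B) : A.toMatroid = B.toMatroid := by
  refine Matroid.ext_indep rfl fun I _ => ?_
  rw [toMatroid_indep_iff, toMatroid_indep_iff, linearIndepOn_iff_linearIndepOn_finset,
    linearIndepOn_iff_linearIndepOn_finset]
  refine and_congr_right fun _ => forall₂_congr fun t _ => ?_
  have hA := linearIndependent_col_iff_exists_det_ne_zero (A.submatrix id (Subtype.val : t → E))
  have hB := linearIndependent_col_iff_exists_det_ne_zero (B.submatrix id (Subtype.val : t → E))
  refine hA.trans (Iff.trans (exists_congr fun f => ?_) hB.symm)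
  exact not_congr ((h.submatrix _ _).submatrix _ _).det_eq_zero_iff

/-! ### Standard representations and their signings -/

section standardRepr

variable {α : Type u} {X Y : Set α} {R : Type w} [DivisionRing R]

theorem prependOne_of_mem (S : Matrix X Y R) (i : X) (e : (X ∪ Y : Set α)) (he : (e : α) ∈ X) :
    S.prependOne i e = if (i : α) = e then 1 else 0 := by
  simp [prependOne, he]

theorem prependOne_col_of_mem (S : Matrix X Y R) (e : (X ∪ Y : Set α)) (he : (e : α) ∈ X) :
    S.prependOne.col e = Pi.single ⟨e, he⟩ 1 := by
  ext i
  rw [col_apply, prependOne_of_mem _ _ _ he]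
  simp [Pi.single_apply, Subtype.ext_iff]

theorem prependOne_of_notMem (S : Matrix X Y R) (i : X) (e : (X ∪ Y : Set α)) (he : (e : α) ∉ X) :
    S.prependOne i e = S i ⟨e, e.2.resolve_left he⟩ := by
  simp [prependOne, he]

theorem IsTotallyUnimodular.prependOne {S : Matrix X Y ℚ} (hS : S.IsTotallyUnimodular) :
    S.prependOne.IsTotallyUnimodular := by
  convert hS.one_fromCols.submatrix id fun e : (X ∪ Y : Set α) =>
    if h : (e : α) ∈ X then Sum.inl ⟨e, h⟩ else Sum.inr ⟨e, e.2.resolve_left h⟩ using 1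
  ext i e
  by_cases he : (e : α) ∈ X
  · simp [prependOne_of_mem _ _ _ he, he, one_apply, Subtype.ext_iff]
  · simp [prependOne_of_notMem _ _ _ he, he]

theorem IsSigningOf.prependOne {S : Matrix X Y ℚ} {B : Matrix X Y (ZMod 2)}
    (h : S.IsSigningOf B) : S.prependOne.IsSigningOf B.prependOne := by
  refine ⟨h.1.prependOne, fun i e => ?_⟩
  by_cases he : (e : α) ∈ X
  · rw [prependOne_of_mem _ _ _ he, prependOne_of_mem _ _ _ he]
    by_cases hi : (i : α) = e
    · exact ⟨1, by simp [hi]⟩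
    · exact ⟨0, by simp [hi]⟩
  · rw [prependOne_of_notMem _ _ _ he, prependOne_of_notMem _ _ _ he]
    exact h.2 _ _

theorem IsSigningOf.isRegular {S : Matrix X Y ℚ} {B : Matrix X Y (ZMod 2)} (h : S.IsSigningOf B)
    {M : Matroid α} (hB : B.IsStandardReprOf M) : M.IsRegular :=
  ⟨X, X ∪ Y, S.prependOne, h.1.prependOne, h.prependOne.toMatroid_eq.trans hB.2⟩

theorem prependOne_indep_left (S : Matrix X Y R) : S.prependOne.toMatroid.Indep X := by
  refine ⟨Set.subset_union_left, ?_⟩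
  have : LinearIndependent R fun x : X => (Pi.single x 1 : X → R) :=
    Pi.linearIndependent_single_one X R
  have h2 := this.comp (fun e : {e : (X ∪ Y : Set α) | (e : α) ∈ X} => (⟨e, e.2⟩ : X))
    fun e f hef => by simpa [Subtype.ext_iff] using hef
  have h3 : (fun e : {e : (X ∪ Y : Set α) | (e : α) ∈ X} => S.prependOne.col e.1) =
      (fun x : X => (Pi.single x 1 : X → R)) ∘ (fun e => ⟨e.1, e.2⟩) :=
    funext fun e => prependOne_col_of_mem S e e.2
  rw [← h3] at h2
  exact h2

/-- The closure of a set of unit columns is a coordinate subspace; with finitely many rows, every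
column is a combination of unit columns. This recovers the support of `S` from the matroid. -/
theorem prependOne_mem_closure_iff [Finite X] (S : Matrix X Y R) (hXY : Disjoint X Y) {T : Set α}
    (hT : T ⊆ X) (y : Y) :
    (y : α) ∈ S.prependOne.toMatroid.closure T ↔ ∀ x : X, (x : α) ∉ T → S x y = 0 := by
  have := Fintype.ofFinite X
  have hcol : ∀ x, S.prependOne x ⟨y, Or.inr y.2⟩ = S x y := fun x =>
    prependOne_of_notMem _ _ _ (hXY.notMem_of_mem_right y.2)
  rw [toMatroid_mem_closure_iff _ (hT.trans Set.subset_union_left) ⟨y, Or.inr y.2⟩]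
  constructor
  · intro h x hx
    rw [← hcol]
    have hle : Submodule.span R (S.prependOne.col '' {f : (X ∪ Y : Set α) | (f : α) ∈ T}) ≤
        LinearMap.ker (LinearMap.proj (R := R) (φ := fun _ : X => R) x) := by
      rw [Submodule.span_le]
      rintro _ ⟨f, hf, rfl⟩
      have hne : (x : α) ≠ f := fun h => hx (h ▸ hf)
      simp [prependOne_of_mem _ _ _ (hT hf), hne]
    exact hle h
  · intro h
    rw [pi_eq_sum_univ' (S.prependOne.col _)]
    refine Submodule.sum_mem _ fun x _ => ?_
    by_cases hx : (x : α) ∈ T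
    · refine Submodule.smul_mem _ _ (Submodule.subset_span ⟨⟨x, Or.inl x.2⟩, hx, ?_⟩)
      rw [prependOne_col_of_mem S ⟨x, Or.inl x.2⟩ x.2]
    · rw [col_apply, hcol, h x hx, zero_smul]
      exact Submodule.zero_mem _

theorem IsStandardReprOf.finite {S : Matrix X Y R} {M : Matroid α} [M.RankFinite]
    (h : S.IsStandardReprOf M) : X.Finite := by
  have := S.prependOne_indep_left
  rw [h.2] at this
  exact this.finite

theorem IsStandardReprOf.rankFinite [Finite X] {S : Matrix X Y R} {M : Matroid α}
    (h : S.IsStandardReprOf M) : M.RankFinite :=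
  h.2 ▸ toMatroid_rankFinite _

/-- A standard representation over `ZMod 2` of a regular matroid of finite rank has a totally
unimodular signing. -/
theorem IsStandardReprOf.exists_isSigningOf [Finite X] {B : Matrix X Y (ZMod 2)} {M : Matroid α}
    (hB : B.IsStandardReprOf M) (hM : M.IsRegular) : ∃ S : Matrix X Y ℚ, S.IsSigningOf B := by
  obtain ⟨hXY, rfl⟩ := hB
  obtain ⟨N, E, A, hA, hAM⟩ := hM
  obtain rfl : E = X ∪ Y := congrArg Matroid.E hAM
  let b : X → (X ∪ Y : Set α) := fun x => ⟨x, Or.inl x.2⟩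
  let g : Y → (X ∪ Y : Set α) := fun y => ⟨y, Or.inr y.2⟩
  have hb : LinearIndependent ℚ fun x => A.col (b x) := by
    have hX := B.prependOne_indep_left
    rw [← hAM] at hX
    exact hX.2.comp (fun x : X => (⟨b x, x.2⟩ : {e : (X ∪ Y : Set α) | (e : α) ∈ X}))
      fun x x' h => by simpa [b, Subtype.ext_iff] using h
  have himage : ∀ T ⊆ X, A.col '' {f : (X ∪ Y : Set α) | (f : α) ∈ T} =
      (fun x => A.col (b x)) '' {x | (x : α) ∈ T} := by
    intro T hT
    ext v
    constructor
    · rintro ⟨f, hf, rfl⟩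
      exact ⟨⟨f, hT hf⟩, hf, rfl⟩
    · rintro ⟨x, hx, rfl⟩
      exact ⟨b x, hx, rfl⟩
  -- Membership in the closure of T transfers from the binary matrix to `A`, since both represent
  -- the same matroid.
  have hmem : ∀ T ⊆ X, ∀ y : Y, A.col (g y) ∈
      Submodule.span ℚ ((fun x => A.col (b x)) '' {x | (x : α) ∈ T}) ↔
        ∀ x : X, (x : α) ∉ T → B x y = 0 := by
    intro T hT y
    rw [← prependOne_mem_closure_iff B hXY hT y, ← hAM, ← himage T hT,
      ← toMatroid_mem_closure_iff A (hT.trans Set.subset_union_left)]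
  have hs : ∀ y, ∃ s : X →₀ ℚ,
      A.col (g y) = Finsupp.linearCombination ℚ (fun x => A.col (b x)) s := by
    intro y
    have := (hmem X subset_rfl y).2 fun x hx => absurd x.2 hx
    obtain ⟨s, -, hs⟩ := (Finsupp.mem_span_image_iff_linearCombination ℚ).1 this
    exact ⟨s, hs.symm⟩
  choose s hs using hs
  refine ⟨_, isSigningOf_of_apply_eq_zero_iff (hA.of_linearCombination b g hb s hs) fun x y => ?_⟩
  -- Omitting one base element isolates one entry: the coordinate of `y` at `x` is zero iff `y` is
  -- in the closure of the other base elements.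
  have h1 := hmem (X \ {(x : α)}) Set.sdiff_subset y
  have h2 : (∀ x' : X, (x' : α) ∉ X \ {(x : α)} → B x' y = 0) ↔ B x y = 0 := by
    constructor
    · intro h
      exact h x (by simp)
    · intro h x' hx'
      obtain rfl : x' = x := by simpa [Subtype.ext_iff] using hx'
      exact h
  rw [← h2, ← h1, Finsupp.mem_span_image_iff_linearCombination, of_apply]
  constructor
  · intro h
    refine ⟨s y, ?_, (hs y).symm⟩
    rw [Finsupp.mem_supported']
    intro x' hx'
    obtain rfl : x' = x := by simpa [Subtype.ext_iff] using hx'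
    exact h
  · rintro ⟨l, hl, hls⟩
    rw [hs y] at hls
    have := hb hls
    rw [← this]
    exact (Finsupp.mem_supported' _ _).1 hl x (by simp)

end standardRepr

/-! ### Graphic and cographic matroids -/

/-- Poincaré's lemma. -/
theorem IsGraphic.isTotallyUnimodular {X : Type v} {Y : Type w} {A : Matrix X Y ℚ}
    (hA : A.IsGraphic) : A.IsTotallyUnimodular := by
  intro k
  induction k with
  | zero => intro _ _ _ _; exact ⟨1, by simp⟩
  | succ k ih =>
    intro f g hf hg
    by_cases hsum : ∀ j, ∑ i, A (f i) (g j) = 0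
    · refine ⟨0, ?_⟩
      -- All column sums vanish, so the all-ones vector is in the left kernel.
      rw [SignType.coe_zero, eq_comm, ← exists_vecMul_eq_zero_iff]
      refine ⟨fun _ => 1, fun h => one_ne_zero (congrFun h 0), ?_⟩
      ext j
      simpa [vecMul, dotProduct] using hsum j
    · push Not at hsum
      obtain ⟨j, hj⟩ := hsum
      -- A column with nonzero sum has met only one of its two nonzero rows, so expansion along it
      -- leaves a single term.
      obtain ⟨i, hi, hi'⟩ : ∃ i, A (f i) (g j) ∈ Set.range (SignType.cast : SignType → ℚ) ∧
          ∀ i', i' ≠ i → A (f i') (g j) = 0 := by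
        rcases hA (g j) with h0 | ⟨p, q, hpq, hp, hq, h0⟩
        · simp [h0] at hj
        by_cases hpf : ∃ i, f i = p <;> by_cases hqf : ∃ i, f i = q
        · obtain ⟨i, rfl⟩ := hpf
          obtain ⟨i', rfl⟩ := hqf
          refine absurd ?_ hj
          have hne : i ≠ i' := fun h => hpq (by rw [h])
          rw [Finset.sum_eq_add i i' hne, hp, hq]
          · norm_num
          · intro c _ hc
            exact h0 _ (fun h => hc.1 (hf h)) (fun h => hc.2 (hf h))
          · simp
          · simp
        · obtain ⟨i, rfl⟩ := hpf
          exact ⟨i, ⟨1, by simp [hp]⟩, fun i' hi' => h0 _ (fun h => hi' (hf h)) fun h => hqf ⟨_, h⟩⟩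
        · obtain ⟨i, rfl⟩ := hqf
          exact ⟨i, ⟨-1, by simp [hq]⟩, fun i' hi' =>
            h0 _ (fun h => hpf ⟨_, h⟩) fun h => hi' (hf h)⟩
        · refine absurd (Finset.sum_eq_zero fun i _ => ?_) hj
          exact h0 _ (fun h => hpf ⟨_, h⟩) fun h => hqf ⟨_, h⟩
      rw [det_succ_column _ j, Finset.sum_eq_single i]
      · rw [mul_assoc, neg_one_pow_mul_mem_range_signType_cast_iff]
        refine mul_mem_range_signType_cast hi ?_
        exact ih (f ∘ i.succAbove) (g ∘ j.succAbove)
          (hf.comp i.succAbove_right_injective) (hg.comp j.succAbove_right_injective)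
      · intro i' _ hne
        simp [hi' i' hne]
      · simp

theorem IsTotallyUnimodular.neg {m n : Type*} {A : Matrix m n ℚ} (hA : A.IsTotallyUnimodular) :
    (-A).IsTotallyUnimodular := by
  intro k f g hf hg
  rw [submatrix_neg, Pi.neg_apply, Pi.neg_apply, det_neg,
    neg_one_pow_mul_mem_range_signType_cast_iff]
  exact hA k f g hf hg

/-- Linear duality. By `hr` and `hφ`, a finitely supported dependency among the vectors (r y e)_y is
the family of values on `v` of a functional. Its support lies in `I` iff the functional kills `v`
outside `I`, so only the zero dependency is supported in `I` iff the vectors outside `I` span. -/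
theorem linearIndepOn_iff_forall_mem_span_compl {E V Y : Type*} [AddCommGroup V] [Module ℚ V]
    [Finite Y] (v : E → V) (r : Y → E →₀ ℚ) (hr : ∀ y, Finsupp.linearCombination ℚ v (r y) = 0)
    (hφ : ∀ c : E → ℚ, (∀ y, Finsupp.linearCombination ℚ c (r y) = 0) →
      ∃ φ : V →ₗ[ℚ] ℚ, ∀ e, φ (v e) = c e) (I : Set E) :
    LinearIndepOn ℚ (fun e y => r y e) I ↔ ∀ e, v e ∈ Submodule.span ℚ (v '' Iᶜ) := by
  have hcomm : ∀ (l : E →₀ ℚ) (y : Y), Finsupp.linearCombination ℚ (fun e y => r y e) l y =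
      Finsupp.linearCombination ℚ l (r y) := by
    intro l y
    rw [Finsupp.linearCombination_apply, Finsupp.linearCombination_apply,
      Finsupp.sum_of_support_subset l (s := l.support ∪ (r y).support) Finset.subset_union_left _
        (by simp), Finsupp.sum_of_support_subset (r y) (s := l.support ∪ (r y).support)
        Finset.subset_union_right _ (by simp), Finset.sum_apply]
    exact Finset.sum_congr rfl fun e _ => mul_comm _ _
  constructor
  · intro hI e
    by_contra he
    obtain ⟨φ, hφe, hker⟩ := Submodule.exists_le_ker_of_notMem he
    have hfin : I.Finite := LinearIndependent.finite_of_isNoetherian hI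
    have hsupp : ∀ e, φ (v e) ≠ 0 → e ∈ I := by
      intro e he
      by_contra heI
      exact he (hker (Submodule.subset_span ⟨e, heI, rfl⟩))
    let l : E →₀ ℚ := Finsupp.onFinset hfin.toFinset (fun e => φ (v e)) fun e he => by
      simpa using hsupp e he
    have hl := linearIndepOn_iff.1 hI l ((Finsupp.mem_supported _ _).2 fun e he => hsupp e (by
      simpa [l] using he)) (by
        ext y
        rw [hcomm]
        have : (l : E → ℚ) = fun e => φ (v e) := rfl
        rw [this, Pi.zero_apply, ← map_zero φ, ← hr y, Finsupp.linearCombination_apply,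
          Finsupp.linearCombination_apply, map_finsuppSum]
        simp)
    exact hφe (DFunLike.congr_fun hl e)
  · intro h
    rw [linearIndepOn_iff]
    intro l hl hl0
    obtain ⟨φ, hφl⟩ := hφ l fun y => by rw [← hcomm, hl0, Pi.zero_apply]
    have hle : Submodule.span ℚ (v '' Iᶜ) ≤ LinearMap.ker φ := by
      rw [Submodule.span_le]
      rintro _ ⟨e, he, rfl⟩
      rw [SetLike.mem_coe, LinearMap.mem_ker, hφl]
      exact (Finsupp.mem_supported' _ _).1 hl e he
    ext e
    rw [← hφl]
    exact hle (h e)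

end Matrix

/-- The complement of a base of `M` is a base of the dual. The coordinates of the remaining columns
form a TU matrix, and its negative transpose, preceded by an identity, represents `M`. -/
theorem Matroid.IsCographic.isRegular {α : Type u} {M : Matroid α} [M.RankFinite]
    (hM : M.IsCographic) : M.IsRegular := by
  obtain ⟨N, E, A, hA, hAM⟩ := hM
  have hTU := hA.isTotallyUnimodular
  obtain ⟨Y, hY⟩ := M.exists_isBase
  have hYfin : Finite Y := hY.finite
  have hX := hY.compl_isBase_dual
  have hE : E = Y ∪ (M.E \ Y) := by
    rw [Set.union_sdiff_cancel hY.subset_ground]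
    exact congrArg Matroid.E hAM
  have hdisj : Disjoint Y (M.E \ Y) := Set.disjoint_sdiff_right
  generalize hXdef : M.E \ Y = X at hX hE hdisj
  subst hE
  have hME : M.E = Y ∪ X := (congrArg Matroid.E hAM).symm
  let b : X → (Y ∪ X : Set α) := fun x => ⟨x, Or.inr x.2⟩
  let g : Y → (Y ∪ X : Set α) := fun y => ⟨y, Or.inl y.2⟩
  have hbg : ∀ x y, b x ≠ g y := fun x y h =>
    hdisj.ne_of_mem y.2 x.2 (congrArg Subtype.val h).symm
  have hb : LinearIndependent ℚ fun x => A.col (b x) := by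
    have hX' := hX.indep
    rw [← hAM] at hX'
    exact hX'.2.comp (fun x : X => (⟨b x, x.2⟩ : {e : (Y ∪ X : Set α) | (e : α) ∈ X}))
      fun x x' h => by simpa [b, Subtype.ext_iff] using h
  have hs : ∀ y, ∃ s : X →₀ ℚ,
      A.col (g y) = Finsupp.linearCombination ℚ (fun x => A.col (b x)) s := by
    intro y
    have hcl : (g y : α) ∈ A.toMatroid.closure X := by
      rw [hAM, hX.closure_eq, Matroid.dual_ground, hME]
      exact (g y).2
    rw [Matrix.toMatroid_mem_closure_iff A Set.subset_union_right] at hcl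
    have himage : A.col '' {f : (Y ∪ X : Set α) | (f : α) ∈ X} =
        Set.range fun x => A.col (b x) := by
      ext v
      constructor
      · rintro ⟨f, hf, rfl⟩
        exact ⟨⟨f, hf⟩, rfl⟩
      · rintro ⟨x, rfl⟩
        exact ⟨b x, x.2, rfl⟩
    rw [himage] at hcl
    obtain ⟨s, hs⟩ := (Finsupp.mem_span_range_iff_exists_finsupp).1 hcl
    exact ⟨s, hs.symm⟩
  choose s hs using hs
  let T : Matrix Y X ℚ := Matrix.of fun y x => -s y x
  have hT : T.IsTotallyUnimodular := (hTU.of_linearCombination b g hb s hs).transpose.neg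
  have hbinj : Function.Injective b := fun x x' h => by simpa [b, Subtype.ext_iff] using h
  -- The fundamental relation expressing column `g y` in the base; these relations are the rows of
  -- `T.prependOne`.
  let r : Y → (Y ∪ X : Set α) →₀ ℚ := fun y => Finsupp.single (g y) 1 - Finsupp.mapDomain b (s y)
  have hTr : T.prependOne.col = fun e y => r y e := by
    ext e y
    rw [Matrix.col_apply]
    by_cases he : (e : α) ∈ Y
    · obtain ⟨y', rfl⟩ : ∃ y', e = g y' := ⟨⟨e, he⟩, rfl⟩
      rw [Matrix.prependOne_of_mem _ _ _ he]
      have : g y' ∉ Set.range b := by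
        rintro ⟨x, hx⟩
        exact hbg _ _ hx
      simp only [r, Finsupp.sub_apply, Finsupp.mapDomain_of_notMem_range _ _ this, sub_zero,
        Finsupp.single_apply, Subtype.ext_iff]
      rfl
    · have heX := e.2.resolve_left he
      obtain ⟨x', rfl⟩ : ∃ x', e = b x' := ⟨⟨e, heX⟩, rfl⟩
      rw [Matrix.prependOne_of_notMem _ _ _ he]
      simp [r, Finsupp.mapDomain_apply hbinj, (hbg _ _).symm, T]
      rfl
  refine ⟨Y, Y ∪ X, T.prependOne, hT.prependOne, ?_⟩
  refine Matroid.ext_indep hME.symm fun I hI => ?_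
  have hI' : I ⊆ Y ∪ X := hI
  have hset : {f : (Y ∪ X : Set α) | (f : α) ∈ (Y ∪ X) \ I} =
      {f : (Y ∪ X : Set α) | (f : α) ∈ I}ᶜ := by
    ext f
    exact and_iff_right f.2
  rw [Matrix.toMatroid_indep_iff, hTr, Matrix.linearIndepOn_iff_forall_mem_span_compl A.col]
  -- A set is independent in `M` iff its complement spans the dual.
  · rw [← Matroid.dual_coindep_iff]
    have : M✶.E \ (M✶.E \ I) = I := by
      rw [Matroid.dual_ground, hME, Set.sdiff_sdiff_cancel_left hI']
    rw [← this, ← Matroid.spanning_iff_compl_coindep Set.sdiff_subset, this, Matroid.spanning_iff,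
      and_iff_left Set.sdiff_subset, and_iff_right hI', Matroid.dual_ground, hME, ← hAM]
    constructor
    · intro h
      refine subset_antisymm (A.toMatroid.closure_subset_ground _) fun e he => ?_
      refine (A.toMatroid_mem_closure_iff Set.sdiff_subset ⟨e, he⟩).2 ?_
      rw [hset]
      exact h ⟨e, he⟩
    · intro h e
      have he : (e : α) ∈ A.toMatroid.closure ((Y ∪ X) \ I) := h.symm.subset e.2
      rwa [A.toMatroid_mem_closure_iff Set.sdiff_subset, hset] at he
  · intro y
    rw [map_sub, Finsupp.linearCombination_single, one_smul, Finsupp.linearCombination_mapDomain,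
      sub_eq_zero]
    exact hs y
  · intro c hc
    -- A functional can be prescribed on the base columns and extended; the relations then force the
    -- right values on the columns `g y`.
    obtain ⟨φ, hφ⟩ :=
      LinearMap.exists_extend ((Finsupp.linearCombination ℚ (fun x => c (b x))) ∘ₗ hb.repr)
    have hφb : ∀ x, φ (A.col (b x)) = c (b x) := by
      intro x
      have := LinearMap.congr_fun hφ ⟨A.col (b x), Submodule.subset_span ⟨x, rfl⟩⟩
      rw [LinearMap.comp_apply, LinearMap.comp_apply, hb.repr_eq_single x _ rfl] at this
      simpa using this
    refine ⟨φ, fun e => ?_⟩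
    by_cases he : (e : α) ∈ Y
    · obtain ⟨y', rfl⟩ : ∃ y', e = g y' := ⟨⟨e, he⟩, rfl⟩
      have hce := hc y'
      rw [map_sub, Finsupp.linearCombination_single, one_smul, Finsupp.linearCombination_mapDomain,
        sub_eq_zero] at hce
      rw [hs, hce, Finsupp.linearCombination_apply, Finsupp.linearCombination_apply, map_finsuppSum]
      simp [hφb]
    · exact hφb ⟨e, e.2.resolve_left he⟩

/-! ### Relabelling, and R10 -/

namespace Matrix

theorem toMatroid_submatrix_equiv {α : Type u} {X : Type v} {X' : Type w} {E : Set α}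
    (A : Matrix X E ℚ) (e : X' ≃ X) : (A.submatrix e id).toMatroid = A.toMatroid := by
  refine Matroid.ext_indep rfl fun I _ => ?_
  rw [toMatroid_indep_iff, toMatroid_indep_iff]
  refine and_congr_right fun _ => ?_
  let φ : (X → ℚ) →ₗ[ℚ] X' → ℚ := LinearMap.funLeft ℚ ℚ e
  have hφ : LinearMap.ker φ = ⊥ :=
    LinearMap.ker_eq_bot.2 (LinearMap.funLeft_injective_of_surjective ℚ ℚ e e.surjective)
  exact φ.linearIndependent_iff (v := fun i : {i : E | (i : α) ∈ I} => A.col i) hφ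

theorem toMatroid_map {α : Type u} {β : Type w} {X : Type v} {E : Set α} (A : Matrix X E ℚ)
    (f : α → β) (hf : Set.InjOn f A.toMatroid.E) :
    A.toMatroid.map f hf = (A.submatrix id (Equiv.Set.imageOfInjOn f E hf).symm).toMatroid := by
  have hval : ∀ e : E, ((Equiv.Set.imageOfInjOn f E hf e : f '' E) : β) = f e := fun _ => rfl
  refine Matroid.ext_indep rfl fun I hI => ?_
  rw [Matroid.map_indep_iff, toMatroid_indep_iff]
  have hcol : (A.submatrix id (Equiv.Set.imageOfInjOn f E hf).symm).col =
      A.col ∘ (Equiv.Set.imageOfInjOn f E hf).symm := rfl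
  rw [hcol, linearIndepOn_equiv, and_iff_right (show I ⊆ f '' E from hI)]
  have himage : ∀ J ⊆ E, (Equiv.Set.imageOfInjOn f E hf).symm '' {e | (e : β) ∈ f '' J} =
      {e : E | (e : α) ∈ J} := by
    intro J hJ
    ext e
    rw [Equiv.image_symm_eq_preimage, Set.mem_preimage, Set.mem_ofPred_eq, hval,
      hf.mem_image_iff (show J ⊆ A.toMatroid.E from hJ) (show (e : α) ∈ A.toMatroid.E from e.2)]
    rfl
  constructor
  · rintro ⟨J, hJ, rfl⟩
    rw [himage J hJ.1]
    exact hJ.2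
  · intro h
    obtain ⟨J, hJ, rfl⟩ := Set.subset_image_iff.1 (show I ⊆ f '' E from hI)
    rw [himage J hJ] at h
    exact ⟨J, ⟨hJ, h⟩, rfl⟩

/-- The determinant of an integer matrix, computed by expansion along the first row. -/
def laplaceDet : (k : ℕ) → (Fin k → Fin k → ℤ) → ℤ
  | 0, _ => 1
  | k + 1, A => ∑ j : Fin (k + 1), (-1) ^ (j : ℕ) * A 0 j *
      laplaceDet k fun i l => A i.succ (j.succAbove l)

theorem laplaceDet_eq_det (k : ℕ) (A : Matrix (Fin k) (Fin k) ℤ) : laplaceDet k A = A.det := by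
  induction k with
  | zero => simp [laplaceDet]
  | succ k ih =>
    rw [det_succ_row_zero]
    refine Finset.sum_congr rfl fun j _ => ?_
    rw [← ih]
    rfl

/-- Sorting the chosen rows and columns changes a minor only by signs, so increasing selections
suffice. This leaves a finite check, with determinants in a recursive form that can be evaluated. -/
theorem isTotallyUnimodular_map_intCast {m n : ℕ} (A : Matrix (Fin m) (Fin n) ℤ)
    (h : ∀ k ≤ m, ∀ f : Fin k → Fin m, (∀ a b, a < b → f a < f b) →
      ∀ g : Fin k → Fin n, (∀ a b, a < b → g a < g b) →
        |laplaceDet k fun i j => A (f i) (g j)| ≤ 1) :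
    (A.map (Int.cast : ℤ → ℚ)).IsTotallyUnimodular := by
  intro k f g hf hg
  have hkm : k ≤ m := by simpa using Fintype.card_le_of_injective f hf
  have key := h k hkm (f ∘ Tuple.sort f)
    (fun a b hab => (Tuple.monotone_sort f).strictMono_of_injective
      (hf.comp (Equiv.injective _)) hab) (g ∘ Tuple.sort g)
    (fun a b hab => (Tuple.monotone_sort g).strictMono_of_injective
      (hg.comp (Equiv.injective _)) hab)
  have hdet : (laplaceDet k fun i j => A ((f ∘ Tuple.sort f) i) ((g ∘ Tuple.sort g) j)) =
      Equiv.Perm.sign (Tuple.sort f) *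
        (Equiv.Perm.sign (Tuple.sort g) * (A.submatrix f g).det) := by
    refine (laplaceDet_eq_det k
      (((A.submatrix f g).submatrix id (Tuple.sort g)).submatrix (Tuple.sort f) id)).trans ?_
    rw [det_permute, det_permute', Int.cast_id, Int.cast_id]
  rw [hdet, abs_mul, abs_mul] at key
  have hs : ∀ σ : Equiv.Perm (Fin k), |((Equiv.Perm.sign σ : ℤˣ) : ℤ)| = 1 := by
    intro σ
    rcases Int.units_eq_one_or (Equiv.Perm.sign σ) with h | h <;> simp [h]
  rw [hs, hs, one_mul, one_mul] at key
  have := intCast_mem_range_signType_cast key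
  rw [Int.cast_det] at this
  exact this

/-- The standard representation matrix of `R10`, read over the integers. -/
def intMatrixR10 : Matrix (Fin 5) (Fin 5) ℤ :=
  !![1, 0, 0, 1, 1;
     1, 1, 0, 0, 1;
     0, 1, 1, 0, 1;
     0, 0, 1, 1, 1;
     1, 1, 1, 1, 1]

theorem intMatrixR10_isTotallyUnimodular :
    (intMatrixR10.map (Int.cast : ℤ → ℚ)).IsTotallyUnimodular := by
  refine isTotallyUnimodular_map_intCast _ fun k hk => ?_
  interval_cases k <;> decide +kernel

end Matrix

theorem exists_isSigningOf_matrixR10 : ∃ S, Matrix.IsSigningOf S matrixR10 := by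
  refine ⟨_, Matrix.intMatrixR10_isTotallyUnimodular.submatrix
    (fun i : {i : Fin 10 | (i : ℕ) < 5} => (⟨(i : Fin 10), i.2⟩ : Fin 5))
    (fun j : {j : Fin 10 | 5 ≤ (j : ℕ)} => (⟨((j : Fin 10) : ℕ) - 5, by omega⟩ : Fin 5)),
    fun i j => ⟨_, rfl, ?_⟩⟩
  have key : ∀ i j : Fin 5, (!![1, 0, 0, 1, 1;
        1, 1, 0, 0, 1;
        0, 1, 1, 0, 1;
        0, 0, 1, 1, 1;
        1, 1, 1, 1, 1] : Matrix (Fin 5) (Fin 5) (ZMod 2)) i j = Matrix.intMatrixR10 i j := by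
    intro i j
    fin_cases i <;> fin_cases j <;> rfl
  exact key _ _

theorem Matroid.IsIsomorphicToR10.isRegular {α : Type u} {M : Matroid α}
    (hM : M.IsIsomorphicToR10) : M.IsRegular := by
  obtain ⟨f, hf, rfl⟩ := hM
  obtain ⟨S, hS⟩ := exists_isSigningOf_matrixR10
  have key : ∀ N : Matroid (Fin 10), S.prependOne.toMatroid = N → ∀ hf : Set.InjOn f N.E,
      (N.map f hf).IsRegular := by
    rintro _ rfl hf
    rw [Matrix.toMatroid_map]
    -- `ULift` moves the row index into the universe of `α`, as `Matroid.IsRegular` demands.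
    exact ⟨ULift {i : Fin 10 | (i : ℕ) < 5}, _, _,
      (hS.1.prependOne.submatrix id _).submatrix Equiv.ulift id,
      Matrix.toMatroid_submatrix_equiv _ _⟩
  exact key _ hS.prependOne.toMatroid_eq hf

/-! ### Induction over good matroids -/

theorem Matroid.IsGood.isRegular {α : Type u} {M : Matroid α} (hM : M.IsGood) :
    M.RankFinite → M.IsRegular := by
  induction hM <;> intro _
  case graphic hM _ =>
    obtain ⟨X, E, A, hA, hAM⟩ := hM
    exact ⟨X, E, A, hA.isTotallyUnimodular, hAM⟩
  case cographic hM _ => exact hM.isRegular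
  case isomorphicR10 hM _ => exact hM.isRegular
  case sum1 hM _ _ ihl ihr _ =>
    obtain ⟨Xl, Yl, Xr, Yr, Bl, Br, hdisj, hl, hr, hB⟩ := hM
    -- The row labels of the sum are independent in a matroid of finite rank, so they are finite,
    -- and so are those of both summands; this provides the finite rank that the induction
    -- hypotheses need.
    have hX := hB.finite
    have : Finite Xl := hX.subset Set.subset_union_left
    have : Finite Xr := hX.subset Set.subset_union_right
    obtain ⟨Sl, hSl⟩ := hl.exists_isSigningOf (ihl hl.rankFinite)
    obtain ⟨Sr, hSr⟩ := hr.exists_isSigningOf (ihr hr.rankFinite)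
    obtain ⟨S, hS⟩ := hSl.exists_sum1 hSr hdisj.2.1 hdisj.2.2.2.2.1
    exact hS.isRegular hB
  case sum2 hM _ _ ihl ihr _ =>
    obtain ⟨Xl, Yl, Xr, Yr, Bl, Br, x, y, -, -, -, hl, hr, hB⟩ := hM
    have hX := hB.finite
    have : Finite Xl := hX.subset Set.subset_union_left
    have : Finite Xr := hX.subset Set.subset_union_right
    obtain ⟨Sl, hSl⟩ := hl.exists_isSigningOf (ihl hl.rankFinite)
    obtain ⟨Sr, hSr⟩ := hr.exists_isSigningOf (ihr hr.rankFinite)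
    obtain ⟨S, hS⟩ := hSl.exists_sum2 hSr x y
    exact hS.isRegular hB
  case sum3 hM _ _ ihl ihr _ =>
    obtain ⟨Xl, Yl, Xr, Yr, Bl, Br, x0, x1, x2, y0, y1, y2, hne, hint, hBl, hBr, hD, hD0, hl, hr,
      hB⟩ := hM
    have hX := hB.finite
    have : Finite Xl := hX.subset Set.subset_union_left
    have : Finite Xr := hX.subset Set.subset_union_right
    obtain ⟨Sl, hSl⟩ := hl.exists_isSigningOf (ihl hl.rankFinite)
    obtain ⟨Sr, hSr⟩ := hr.exists_isSigningOf (ihr hr.rankFinite)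
    have hY : ({y0, y1, y2} : Set α) ⊆ Yl := hint.2.1 ▸ Set.inter_subset_left
    obtain ⟨S, hS⟩ := hSl.exists_sum3 hSr hBl.2.2.1 hBl.2.2.2.1 hBl.2.2.2.2 hBr.1 hBr.2.1
      hBr.2.2.2.2 ⟨hY (by simp), hne.2.2.2.2.1⟩ ⟨hY (by simp), hne.2.2.2.2.2⟩ hD hD0
    exact hS.isRegular hB

theorem mainTheorem1 {α : Type u} (M : Matroid α) [M.RankFinite] (hM : M.IsGood) :
    M.IsRegular :=
  hM.isRegular inferInstance
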